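/- There is a universal constant $C>0$ such that the following holds. Let $H=\sum_{a=1}^{L}H_a$ be a $k$-local stoquastic Hamiltonian on $n$ qubits: each $H_a$ is Hermitian, acts as the identity outside some set of at most $k$ qubits, and has real non-positive off-diagonal entries in the computational basis. Suppose that each $H_a$ has operator norm at most $J$, and let $\Delta$ be the energy gap of $H$, i.e. the difference between the smallest eigenvalue of $H$ that exceeds the ground energy and the ground energy (which may be degenerate); in particular $H$ is assumed to have at least two distinct eigenvalues. Let $|+\rangle$ be the uniform superposition state on $n$ qubits, let $\Pi$ be the orthogonal projection onto the ground subspace of $H$, let $\eta=\sqrt{\langle +|\Pi|+\rangle}$, assume $\eta>0$, and put $|\psi_0\rangle=\frac1\eta\Pi|+\rangle$. Let $0<\varepsilon<1$ and $$B=\eta^{-1/2}L^{5/2}J^{3/2}\Delta^{-3/2}\varepsilon^{-1/2}\bigl(\log(\eta^{-1}\varepsilon^{-1})\bigr)^{3/2}.$$ Then there are an integer $m\ge 0$ and a $2k$-local classical Hamiltonian $H_c$ on $n+m$ bits (a finite sum of real energy terms, each acting on at most $2k$ bits) such that: 1. the marginal on the first $n$ bits of the Gibbs distribution $z\mapsto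 e^{-H_c(z)}/\sum_{z'}e^{-H_c(z')}$ is within total variation distance $\varepsilon$ of the distribution $x\mapsto|\langle x|\psi_0\rangle|^2$; 2. each of the $n+m$ bits is acted on by at most $2$ terms of $H_c$; 3. $H_c$ has at most $C\,B$ terms; 4. the number $m$ of additional (hidden) bits is at most $C\,k\,B$; 5. if every one of the $n$ qubits is acted on non-trivially by at least one term $H_a$, and $\eta\varepsilon\le\frac12$, then the total number of bits satisfies $n+m\le C\,k\,B$. In particular, when $L$, $J$, $\Delta^{-1}$ and $\eta^{-1}$ are at most $\mathrm{poly}(n)$, all these sizes are polynomial in $n$ and $\varepsilon^{-1}$. -/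

import Mathlib

open scoped InnerProductSpace

noncomputable section

/-! ### Quantum side: local stoquastic Hamiltonians on `n` qubits -/

/-- Classical configurations of a set `V` of bits; for `V = Fin n` these label the computational
basis of `n` qubits. -/
abbrev Config (V : Type) : Type := V → Bool

/-- The Hilbert space `(ℂ²)^{⊗ n}` of `n` qubits, with its computational basis. -/
abbrev QubitSpace (n : ℕ) : Type := EuclideanSpace ℂ (Config (Fin n))

/-- Operators on `n` qubits, as matrices in the computational basis. -/
abbrev QubitOp (n : ℕ) : Type := Matrix (Config (Fin n)) (Config (Fin n)) ℂ

/-- `A = B ⊗ I`, with `B` an operator on the qubits in `S` and `I` the identity on the others. -/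
def SupportedOn {n : ℕ} (S : Finset (Fin n)) (A : QubitOp n) : Prop :=
  ∃ B : Matrix (Config S) (Config S) ℂ, ∀ x y : Config (Fin n),
    A x y = if ∀ i, i ∉ S → x i = y i then B (fun i => x i) (fun i => y i) else 0

/-- `A` acts non-trivially on qubit `i`: it is not the identity on `i` tensored with an operator
on the remaining qubits. -/
def ActsNontriviallyOn {n : ℕ} (A : QubitOp n) (i : Fin n) : Prop :=
  ¬ SupportedOn (Finset.univ.erase i) A

/-- A `k`-local Hamiltonian `H = ∑ₐ Hₐ` on `n` qubits with `L` terms, together with the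
decomposition into Hermitian terms, each acting on at most `k` qubits. -/
structure LocalHamiltonian (n k L : ℕ) where
  term : Fin L → QubitOp n
  isHermitian : ∀ a, (term a).IsHermitian
  isLocal : ∀ a, ∃ S : Finset (Fin n), S.card ≤ k ∧ SupportedOn S (term a)

namespace LocalHamiltonian

variable {n k L : ℕ}

/-- The Hamiltonian `H = ∑ₐ Hₐ`. -/
def total (H : LocalHamiltonian n k L) : QubitOp n := ∑ a, H.term a

/-- Every term has real non-positive off-diagonal entries in the computational basis. -/
def IsStoquastic (H : LocalHamiltonian n k L) : Prop :=
  ∀ a x y, x ≠ y → (H.term a x y).im = 0 ∧ (H.term a x y).re ≤ 0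

/-- Every term has operator norm at most `J`. -/
def TermNormLE (H : LocalHamiltonian n k L) (J : ℝ) : Prop :=
  ∀ a, ‖Matrix.toEuclideanCLM (𝕜 := ℂ) (H.term a)‖ ≤ J

/-- The set of eigenvalues (energies) of `H`. -/
def energies (H : LocalHamiltonian n k L) : Set ℝ :=
  {E | Module.End.HasEigenvalue (Matrix.toEuclideanLin H.total) (E : ℂ)}

/-- The smallest eigenvalue of `H`. -/
def groundEnergy (H : LocalHamiltonian n k L) : ℝ := sInf H.energies

/-- `Δ` is the energy gap of `H`: the smallest eigenvalue different from the ground energy is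
`groundEnergy + Δ`. The ground energy may be degenerate. -/
def HasGap (H : LocalHamiltonian n k L) (Δ : ℝ) : Prop :=
  IsLeast {E | E ∈ H.energies ∧ H.groundEnergy < E} (H.groundEnergy + Δ)

/-- The eigenspace of `H` at the ground energy. -/
def groundSpace (H : LocalHamiltonian n k L) : Submodule ℂ (QubitSpace n) :=
  Module.End.eigenspace (Matrix.toEuclideanLin H.total) (H.groundEnergy : ℂ)

/-- The orthogonal projection `Π` onto the ground subspace. -/
def groundProj (H : LocalHamiltonian n k L) : QubitSpace n →L[ℂ] QubitSpace n :=
  H.groundSpace.starProjection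

end LocalHamiltonian

/-- The uniform superposition `|+⟩^{⊗ n}`. -/
def plusState (n : ℕ) : QubitSpace n :=
  WithLp.toLp 2 fun _ => ((1 / Real.sqrt (2 ^ n) : ℝ) : ℂ)

namespace LocalHamiltonian

variable {n k L : ℕ}

/-- `η = √⟨+|Π|+⟩`. -/
def overlap (H : LocalHamiltonian n k L) : ℝ :=
  Real.sqrt (⟪plusState n, H.groundProj (plusState n)⟫_ℂ).re

/-- The ground state `|ψ₀⟩ = η⁻¹ Π |+⟩`. -/
def groundState (H : LocalHamiltonian n k L) : QubitSpace n :=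
  ((H.overlap⁻¹ : ℝ) : ℂ) • H.groundProj (plusState n)

/-- The distribution `x ↦ |⟨x|ψ₀⟩|²` of the ground state. -/
def groundDist (H : LocalHamiltonian n k L) (x : Config (Fin n)) : ℝ :=
  ‖H.groundState x‖ ^ 2

end LocalHamiltonian

/-! ### Classical side: local classical Hamiltonians and Gibbs distributions -/

/-- A classical Hamiltonian on the set `V` of bits: a finite list of real energy terms, each
given with the set of bits it acts on. -/
structure ClassicalHamiltonian (V : Type) where
  numTerms : ℕ
  support : Fin numTerms → Finset V
  term : Fin numTerms → Config V → ℝ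
  term_dependsOn : ∀ a, DependsOn (term a) (support a : Set V)

namespace ClassicalHamiltonian

variable {V : Type}

/-- Total energy. -/
def energy (G : ClassicalHamiltonian V) (z : Config V) : ℝ := ∑ a, G.term a z

/-- Every term acts on at most `k` bits. -/
def IsLocal (G : ClassicalHamiltonian V) (k : ℕ) : Prop := ∀ a, (G.support a).card ≤ k

/-- The number of terms that act on the bit `v`. -/
def degree [DecidableEq V] (G : ClassicalHamiltonian V) (v : V) : ℕ :=
  (Finset.univ.filter fun a => v ∈ G.support a).card

/-- The partition function. -/
def partitionFunction [Fintype V] [DecidableEq V] (G : ClassicalHamiltonian V) : ℝ :=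
  ∑ z : Config V, Real.exp (-G.energy z)

/-- The Gibbs distribution at temperature 1. -/
def gibbs [Fintype V] [DecidableEq V] (G : ClassicalHamiltonian V) (z : Config V) : ℝ :=
  Real.exp (-G.energy z) / G.partitionFunction

/-- The marginal of the Gibbs distribution on the first `n` of `n + m` bits. -/
def gibbsMarginal {n m : ℕ} (G : ClassicalHamiltonian (Fin n ⊕ Fin m)) (x : Config (Fin n)) : ℝ :=
  ∑ h : Config (Fin m), G.gibbs (Sum.elim x h)

end ClassicalHamiltonian

/-- Total variation distance of two distributions on a finite set. -/
def tvDist {α : Type} [Fintype α] (p q : α → ℝ) : ℝ := (1 / 2) * ∑ x, |p x - q x|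

/-- `η^{-1/2} L^{5/2} J^{3/2} Δ^{-3/2} ε^{-1/2} (log(η⁻¹ ε⁻¹))^{3/2}`. -/
def sizeBound (η : ℝ) (L : ℕ) (J Δ ε : ℝ) : ℝ :=
  η ^ (-(1 / 2) : ℝ) * (L : ℝ) ^ (5 / 2 : ℝ) * J ^ (3 / 2 : ℝ) * Δ ^ (-(3 / 2) : ℝ) *
    ε ^ (-(1 / 2) : ℝ) * Real.log (η⁻¹ * ε⁻¹) ^ (3 / 2 : ℝ)

end

/-!
The ground state distribution is reached by imaginary time evolution of the uniform state, written
as a sum over paths of classical configurations.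

Let `q = η ε`. If `q > 1 / 2`, then `√(1 - η²) ≤ ε` and the uniform distribution itself is close
enough (`LocalHamiltonian.exists_gibbsMarginal_uniform`). Otherwise, split the evolution time
`β = 16 log (1 / q) / Δ` into `p` steps of length `t = β / p`. In each step `exp (-t H)` is replaced
by a palindromic product of the local factors `1 - (t / 2) Hₐ + (t² / 8) Hₐ²`. These equal half of
`1 + (1 - (t / 2) Hₐ)²`, so they are entrywise non-negative for a stoquastic `Hₐ` and small `t`,
and they act on the same qubits as `Hₐ`; no matrix exponential is needed. The palindrome matches
`1 - t H + t² H² / 2` up to an error of order `(t L J)³` (`HasJet.palindrome`), and the powers of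
that polynomial in `H` contract every excited eigenvector relative to the ground space by
`exp (-t Δ / 4)` per step (`LocalHamiltonian.norm_taylorStep_pow_sub_le`). Hence the total error is
of order `β³ L³ J³ / p² + q⁴`, which is small against `q` as soon as `p` is a constant times
`(β L J)^{3/2} q^{-1/2}`; with `2 L` factors per step this is the count in `sizeBound`.

A small perturbation makes all local factors strictly positive on their supports
(`exists_positive_gates_approx`), so that they are Boltzmann weights. Expanding the product of the
factors applied to the all-ones vector over intermediate configurations, each factor is one energy
term linking the current bits of its support to fresh hidden bits (`exists_represents`). It acts on
at most `2 k` bits, and a hidden bit is touched only by the factor creating it and by the next one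
acting on its qubit. The amplitude of `x` is thus a sum over hidden bits, and its square is obtained
from two copies coupled to the same visible bits, each of which is then acted on at most twice
(`Represents.exists_gibbsMarginal`).
-/

/-! ### Second-order product formula in a normed algebra -/

section Jets

variable {𝔸 : Type*} [NormedRing 𝔸] [NormedAlgebra ℂ 𝔸] [NormOneClass 𝔸]

/-- `A = 1 + X + Y + (remainder)`, where the orders one, two and `≥ 3` are dominated by the
corresponding parts of the power series of `exp s`. -/
structure HasJet (A X Y : 𝔸) (s : ℝ) : Prop where
  first : ‖X‖ ≤ s
  second : ‖Y‖ ≤ s ^ 2 / 2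
  remainder : ‖A - (1 + X + Y)‖ ≤ Real.exp s - (1 + s + s ^ 2 / 2)

omit [NormedAlgebra ℂ 𝔸] in
theorem HasJet.norm_le {A X Y : 𝔸} {s : ℝ} (h : HasJet A X Y s) : ‖A‖ ≤ Real.exp s := by
  have h1 : A = (A - (1 + X + Y)) + (1 + X + Y) := by abel
  have h2 : ‖1 + X + Y‖ ≤ 1 + s + s ^ 2 / 2 :=
    (norm_add₃_le).trans (by rw [norm_one]; linarith [h.first, h.second])
  rw [h1]
  exact (norm_add_le _ _).trans (by linarith [h.remainder])

omit [NormedAlgebra ℂ 𝔸] in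
theorem HasJet.mul {A X Y A' X' Y' : 𝔸} {s s' : ℝ} (h : HasJet A X Y s)
    (h' : HasJet A' X' Y' s') :
    HasJet (A * A') (X + X') (Y + X * X' + Y') (s + s') := by
  have hs : 0 ≤ s := (norm_nonneg _).trans h.first
  have hs' : 0 ≤ s' := (norm_nonneg _).trans h'.first
  have mul_le : ∀ {a b : 𝔸} {r t : ℝ}, ‖a‖ ≤ r → ‖b‖ ≤ t → ‖a * b‖ ≤ r * t := fun {a b r t} ha hb =>
    (norm_mul_le a b).trans (mul_le_mul ha hb (norm_nonneg _) ((norm_nonneg _).trans ha))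
  refine ⟨(norm_add_le _ _).trans (add_le_add h.first h'.first), ?_, ?_⟩
  · refine (norm_add₃_le).trans ?_
    nlinarith [h.second, h'.second, mul_le h.first h'.first]
  · have key : A * A' - (1 + (X + X') + (Y + X * X' + Y')) =
        (A - (1 + X + Y)) * A' + (1 + X + Y) * (A' - (1 + X' + Y')) +
          (X * Y' + Y * X' + Y * Y') := by noncomm_ring
    have h2 : ‖1 + X + Y‖ ≤ 1 + s + s ^ 2 / 2 :=
      (norm_add₃_le).trans (by rw [norm_one]; linarith [h.first, h.second])
    have e1 := mul_le h.remainder h'.norm_le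
    have e2 := mul_le h2 h'.remainder
    have e3 : ‖X * Y' + Y * X' + Y * Y'‖ ≤
        s * (s' ^ 2 / 2) + s ^ 2 / 2 * s' + s ^ 2 / 2 * (s' ^ 2 / 2) :=
      (norm_add₃_le).trans (add_le_add (add_le_add (mul_le h.first h'.second)
        (mul_le h.second h'.first)) (mul_le h.second h'.second))
    rw [key, Real.exp_add]
    refine (norm_add₃_le).trans ?_
    nlinarith [e1, e2, e3]

omit [NormOneClass 𝔸] in
theorem HasJet.of_norm_le {X : 𝔸} {s : ℝ} (h : ‖X‖ ≤ s) :
    HasJet (1 + X + (2⁻¹ : ℂ) • X ^ 2) X ((2⁻¹ : ℂ) • X ^ 2) s := by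
  have hs : 0 ≤ s := (norm_nonneg _).trans h
  refine ⟨h, ?_, ?_⟩
  · have h1 : ‖(2⁻¹ : ℂ)‖ = 2⁻¹ := by simp
    have h2 : ‖X ^ 2‖ ≤ s ^ 2 := (norm_pow_le' X two_pos).trans (by gcongr)
    rw [norm_smul, h1]
    linarith
  · rw [sub_self, norm_zero]
    linarith [Real.quadratic_le_exp_of_nonneg hs]

/-- The palindromic product formula is exact up to second order: multiplying on both sides by the
same second-order factor keeps the second-order part equal to half the square of the first. -/
theorem HasJet.palindrome {ι : Type*} {X : ι → 𝔸} {s : ℝ} (hX : ∀ a, ‖X a‖ ≤ s) (l : List ι) :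
    HasJet ((l.map fun a => 1 + X a + (2⁻¹ : ℂ) • X a ^ 2).prod *
        (l.reverse.map fun a => 1 + X a + (2⁻¹ : ℂ) • X a ^ 2).prod)
      ((2 : ℂ) • (l.map X).sum) ((2⁻¹ : ℂ) • ((2 : ℂ) • (l.map X).sum) ^ 2)
      (2 * l.length * s) := by
  induction l with
  | nil => simpa using HasJet.of_norm_le (X := (0 : 𝔸)) (s := 0) (by simp)
  | cons a l ih =>
    have h := ((HasJet.of_norm_le (hX a)).mul ih).mul (HasJet.of_norm_le (hX a))
    convert h using 1
    · simp only [List.map_cons, List.prod_cons, List.reverse_cons, List.map_append,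
        List.prod_append, List.map_nil, List.prod_nil, mul_one]
      simp only [mul_assoc]
    · simp only [List.map_cons, List.sum_cons, smul_add, two_smul]
      abel
    · simp only [List.map_cons, List.sum_cons]
      generalize (l.map X).sum = Z
      -- All scalars are brought to the form `2⁻¹ • _`, leaving an identity over the integers.
      have h2 : ∀ W : 𝔸, (2 : ℂ) • W = 2 * W := fun W => by rw [two_smul, two_mul]
      have h3 : ∀ W : 𝔸, W = (2⁻¹ : ℂ) • (2 * W) := fun W => by
        rw [← h2, smul_smul]; norm_num
      rw [h3 (X a * (2 : ℂ) • Z), h3 ((X a + (2 : ℂ) • Z) * X a), ← smul_add, ← smul_add,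
        ← smul_add, ← smul_add, h2, h2]
      congr 1
      noncomm_ring
    · push_cast [List.length_cons]
      ring

omit [NormedAlgebra ℂ 𝔸] in
theorem norm_pow_sub_pow_le {S T : 𝔸} {c δ : ℝ} (hT : ‖T‖ ≤ c) (hST : ‖S - T‖ ≤ δ) (p : ℕ) :
    ‖S ^ p - T ^ p‖ ≤ (c + δ) ^ p - c ^ p := by
  have hc : 0 ≤ c := (norm_nonneg _).trans hT
  have hδ : 0 ≤ δ := (norm_nonneg _).trans hST
  have hS : ‖S‖ ≤ c + δ := by
    have : S = T + (S - T) := by abel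
    rw [this]
    exact (norm_add_le _ _).trans (add_le_add hT hST)
  induction p with
  | zero => simp
  | succ p ih =>
    have key : S ^ (p + 1) - T ^ (p + 1) = S * (S ^ p - T ^ p) + (S - T) * T ^ p := by
      rw [pow_succ' S, pow_succ' T]; noncomm_ring
    have h1 : ‖T ^ p‖ ≤ c ^ p := (norm_pow_le T p).trans (by gcongr)
    have e1 : ‖S * (S ^ p - T ^ p)‖ ≤ (c + δ) * ((c + δ) ^ p - c ^ p) :=
      (norm_mul_le _ _).trans (mul_le_mul hS ih (norm_nonneg _) (by positivity))
    have e2 : ‖(S - T) * T ^ p‖ ≤ δ * c ^ p :=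
      (norm_mul_le _ _).trans (mul_le_mul hST h1 (norm_nonneg _) hδ)
    rw [key]
    refine (norm_add_le _ _).trans ((add_le_add e1 e2).trans (le_of_eq ?_))
    ring

end Jets

/-! ### Supports of operators and partial sums over configurations -/

section Splice

variable {n : ℕ}

/-- The configuration that equals `s` on `S` and `x` elsewhere. -/
def splice {S : Finset (Fin n)} (x : Config (Fin n)) (s : Config S) : Config (Fin n) :=
  fun i => if h : i ∈ S then s ⟨i, h⟩ else x i

theorem splice_of_notMem {S : Finset (Fin n)} (x : Config (Fin n)) (s : Config S) {i : Fin n}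
    (h : i ∉ S) : splice x s i = x i := dif_neg h

theorem splice_of_mem {S : Finset (Fin n)} (x : Config (Fin n)) (s : Config S) {i : Fin n}
    (h : i ∈ S) : splice x s i = s ⟨i, h⟩ := dif_pos h

theorem restrict_splice {S : Finset (Fin n)} (x : Config (Fin n)) (s : Config S) :
    (fun i : S => splice x s i) = s := by
  funext i
  exact splice_of_mem x s i.2

/-- The configurations agreeing with `x` off `S` are the splices of `x`. -/
theorem sum_ite_agree {M : Type*} [AddCommMonoid M] (S : Finset (Fin n)) (x : Config (Fin n))
    (f : Config (Fin n) → M) :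
    (∑ y, if ∀ i, i ∉ S → x i = y i then f y else 0) = ∑ s : Config S, f (splice x s) := by
  classical
  rw [← Finset.sum_filter]
  symm
  refine Finset.sum_bij' (fun s _ => splice x s) (fun y _ => fun i => y i) ?_ ?_ ?_ ?_ ?_
  · intro s _
    simp only [Finset.mem_filter, Finset.mem_univ, true_and]
    exact fun i hi => (splice_of_notMem x s hi).symm
  · simp
  · intro s _
    exact restrict_splice x s
  · intro y hy
    simp only [Finset.mem_filter, Finset.mem_univ, true_and] at hy
    funext i
    by_cases h : i ∈ S
    · rw [splice_of_mem _ _ h]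
    · rw [splice_of_notMem _ _ h, hy i h]
  · simp

theorem SupportedOn.one (S : Finset (Fin n)) : SupportedOn S (1 : QubitOp n) := by
  classical
  refine ⟨1, fun x y => ?_⟩
  simp only [Matrix.one_apply, funext_iff, Subtype.forall]
  by_cases h : ∀ i, i ∉ S → x i = y i
  · simp only [if_pos h]
    refine if_congr ⟨fun H i _ => H i, fun H i => ?_⟩ rfl rfl
    by_cases hi : i ∈ S
    · exact H i hi
    · exact h i hi
  · rw [if_neg h, if_neg]
    exact fun H => h fun i _ => H i

theorem SupportedOn.smul {S : Finset (Fin n)} {A : QubitOp n} (h : SupportedOn S A) (c : ℂ) :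
    SupportedOn S (c • A) := by
  obtain ⟨B, hB⟩ := h
  exact ⟨c • B, fun x y => by simp [hB]⟩

theorem SupportedOn.add {S : Finset (Fin n)} {A A' : QubitOp n} (h : SupportedOn S A)
    (h' : SupportedOn S A') : SupportedOn S (A + A') := by
  obtain ⟨B, hB⟩ := h
  obtain ⟨B', hB'⟩ := h'
  refine ⟨B + B', fun x y => ?_⟩
  rw [Matrix.add_apply, hB, hB']
  split_ifs <;> simp

theorem SupportedOn.mul {S : Finset (Fin n)} {A A' : QubitOp n} (h : SupportedOn S A)
    (h' : SupportedOn S A') : SupportedOn S (A * A') := by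
  obtain ⟨B, hB⟩ := h
  obtain ⟨B', hB'⟩ := h'
  refine ⟨B * B', fun x z => ?_⟩
  have h1 : ∀ s : Config S, (∀ i, i ∉ S → splice x s i = z i) ↔ ∀ i, i ∉ S → x i = z i :=
    fun s => forall₂_congr fun i hi => by rw [splice_of_notMem x s hi]
  rw [Matrix.mul_apply]
  simp only [hB, ite_mul, zero_mul]
  rw [sum_ite_agree S x]
  simp only [hB', h1, restrict_splice]
  split_ifs
  · rfl
  · simp

/-- Enlarging the set of qubits: the kernel of the identity is inserted on the new ones. -/
theorem SupportedOn.mono {S S' : Finset (Fin n)} (hS : S ⊆ S') {A : QubitOp n}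
    (h : SupportedOn S A) : SupportedOn S' A := by
  classical
  obtain ⟨B, hB⟩ := h
  refine ⟨fun u v => if ∀ i : S', (i : Fin n) ∉ S → u i = v i then
    B (fun i => u ⟨i, hS i.2⟩) (fun i => v ⟨i, hS i.2⟩) else 0, fun x y => ?_⟩
  rw [hB]
  by_cases h : ∀ i, i ∉ S' → x i = y i
  · rw [if_pos h]
    refine if_congr ⟨fun H i hi => H i hi, fun H i hi => ?_⟩ rfl rfl
    by_cases hi' : i ∈ S'
    · exact H ⟨i, hi'⟩ hi
    · exact h i hi'
  · rw [if_neg h, if_neg]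
    exact fun H => h fun i hi => H i fun hi' => hi (hS hi')

end Splice

/-! ### Lists of classical energy terms -/

/-- One energy term of a classical Hamiltonian, with the set of bits it acts on. -/
structure EnergyTerm (V : Type) where
  support : Finset V
  energy : Config V → ℝ
  dependsOn : DependsOn energy (support : Set V)

namespace EnergyTerm

variable {V W : Type}

/-- The same term on the relabelled bits `ρ v`. -/
def map (ρ : V ↪ W) (t : EnergyTerm V) : EnergyTerm W where
  support := t.support.map ρ
  energy z := t.energy (z ∘ ρ)
  dependsOn z z' h := t.dependsOn fun v hv => h (ρ v) (by
    simpa using hv)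

/-- The number of terms of the list acting on the bit `v`. -/
def degree [DecidableEq V] (l : List (EnergyTerm V)) (v : V) : ℕ :=
  l.countP fun t => v ∈ t.support

/-- The total energy of a list of terms. -/
def total (l : List (EnergyTerm V)) (z : Config V) : ℝ := (l.map fun t => t.energy z).sum

theorem total_map (ρ : V ↪ W) (l : List (EnergyTerm V)) (z : Config W) :
    total (l.map (map ρ)) z = total l (z ∘ ρ) := by
  simp [total, map, Function.comp_def]

theorem total_append (l l' : List (EnergyTerm V)) (z : Config V) :
    total (l ++ l') z = total l z + total l' z := by
  simp [total]

theorem total_cons (t : EnergyTerm V) (l : List (EnergyTerm V)) (z : Config V) :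
    total (t :: l) z = t.energy z + total l z := by
  simp [total]

theorem degree_append [DecidableEq V] (l l' : List (EnergyTerm V)) (v : V) :
    degree (l ++ l') v = degree l v + degree l' v := by
  simp [degree]

theorem degree_cons [DecidableEq V] (t : EnergyTerm V) (l : List (EnergyTerm V)) (v : V) :
    degree (t :: l) v = degree l v + if v ∈ t.support then 1 else 0 := by
  simp [degree, List.countP_cons]

theorem degree_map [DecidableEq V] [DecidableEq W] (ρ : V ↪ W) (l : List (EnergyTerm V)) (v : V) :
    degree (l.map (map ρ)) (ρ v) = degree l v := by
  simp [degree, map, List.countP_map, Function.comp_def]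

theorem degree_map_of_notMem_range [DecidableEq W] (ρ : V ↪ W)
    (l : List (EnergyTerm V)) {w : W} (hw : w ∉ Set.range ρ) :
    degree (l.map (map ρ)) w = 0 := by
  rw [degree, List.countP_eq_zero]
  simp only [List.mem_map, forall_exists_index, and_imp, decide_eq_true_eq]
  rintro _ t _ rfl h
  obtain ⟨v, _, rfl⟩ := Finset.mem_map.1 h
  exact hw ⟨v, rfl⟩

/-- The classical Hamiltonian given by a list of terms. -/
def toHamiltonian (l : List (EnergyTerm V)) : ClassicalHamiltonian V where
  numTerms := l.length
  support a := (l.get a).support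
  term a := (l.get a).energy
  term_dependsOn a := (l.get a).dependsOn

theorem energy_toHamiltonian (l : List (EnergyTerm V)) (z : Config V) :
    (toHamiltonian l).energy z = total l z := by
  simp only [ClassicalHamiltonian.energy, toHamiltonian, total]
  rw [← Fin.sum_univ_fun_getElem]
  rfl

theorem sum_ite_mem_support [DecidableEq V] (l : List (EnergyTerm V)) (v : V) :
    (l.map fun t => if v ∈ t.support then 1 else 0).sum = degree l v := by
  induction l with
  | nil => rfl
  | cons t l ih => rw [List.map_cons, List.sum_cons, ih, degree_cons, add_comm]

theorem degree_toHamiltonian [DecidableEq V] (l : List (EnergyTerm V)) (v : V) :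
    (toHamiltonian l).degree v = degree l v := by
  rw [← sum_ite_mem_support, ← Fin.sum_univ_fun_getElem]
  exact Finset.card_filter _ _

end EnergyTerm

/-! ### Hidden-bit representation of a product of positive gates -/

/-- A `k`-local operator whose kernel `B` on its support `S` is strictly positive, written as
`B = exp (-b)`. -/
def IsPositiveGate {n : ℕ} (k : ℕ) (A : QubitOp n) : Prop :=
  ∃ S : Finset (Fin n), S.card ≤ k ∧ ∃ b : Config S → Config S → ℝ, ∀ x y,
    A x y = if ∀ i, i ∉ S → x i = y i then
      ((Real.exp (-b (fun i => x i) (fun i => y i)) : ℝ) : ℂ) else 0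

/-- The list of terms `l` on visible bits `Fin n` and hidden bits `Hd` represents the vector `φ`,
as the sum over the hidden bits of the Boltzmann weight. A visible bit is acted on at most once, so
that two copies may share it. -/
structure Represents {n : ℕ} (k N : ℕ) (Hd : Type) [Fintype Hd] [DecidableEq Hd]
    (l : List (EnergyTerm (Fin n ⊕ Hd))) (φ : Config (Fin n) → ℂ) : Prop where
  length_eq : l.length = N
  card_le : Fintype.card Hd ≤ k * N
  isLocal : ∀ t ∈ l, t.support.card ≤ 2 * k
  degree_inl : ∀ i, EnergyTerm.degree l (Sum.inl i) ≤ 1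
  degree_inr : ∀ h, EnergyTerm.degree l (Sum.inr h) ≤ 2
  apply_eq : ∀ x, φ x =
    ((∑ h : Config Hd, Real.exp (-EnergyTerm.total l (Sum.elim x h)) : ℝ) : ℂ)

/-- Prepending a gate: the bits of its support become fresh hidden bits `S`, linked to the new
visible bits of `S` by the kernel of the gate; the other visible bits are kept. -/
def freshBits {n : ℕ} (S : Finset (Fin n)) (Hd : Type) : Fin n ⊕ Hd ↪ Fin n ⊕ (S ⊕ Hd) where
  toFun := Sum.elim (fun i => if h : i ∈ S then Sum.inr (Sum.inl ⟨i, h⟩) else Sum.inl i)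
    fun h => Sum.inr (Sum.inr h)
  inj' := by
    rintro (i | h) (j | h') H <;> simp only [Sum.elim_inl, Sum.elim_inr] at H
    · split_ifs at H <;> simp_all
    · split_ifs at H; simp_all
    · split_ifs at H; simp_all
    · simp_all

theorem freshBits_inl_of_mem {n : ℕ} {S : Finset (Fin n)} (Hd : Type) {i : Fin n} (hi : i ∈ S) :
    freshBits S Hd (Sum.inl i) = Sum.inr (Sum.inl ⟨i, hi⟩) := dif_pos hi

theorem freshBits_inl_of_notMem {n : ℕ} {S : Finset (Fin n)} (Hd : Type) {i : Fin n}
    (hi : i ∉ S) : freshBits S Hd (Sum.inl i) = Sum.inl i := dif_neg hi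

theorem freshBits_inr {n : ℕ} (S : Finset (Fin n)) {Hd : Type} (h : Hd) :
    freshBits S Hd (Sum.inr h) = Sum.inr (Sum.inr h) := rfl

theorem elim_comp_freshBits {n : ℕ} (S : Finset (Fin n)) {Hd : Type} (x : Config (Fin n))
    (s : Config S) (h : Config Hd) :
    (Sum.elim x (Sum.elim s h) : Config (Fin n ⊕ (S ⊕ Hd))) ∘ freshBits S Hd =
      Sum.elim (splice x s) h := by
  funext v
  rcases v with i | h'
  · by_cases hi : i ∈ S
    · simp [freshBits_inl_of_mem Hd hi, splice_of_mem x s hi]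
    · simp [freshBits_inl_of_notMem Hd hi, splice_of_notMem x s hi]
  · simp [freshBits_inr]

/-- The energy term of a gate with kernel `exp (-b)`, linking the visible to the fresh bits. -/
def gateTerm {n : ℕ} (S : Finset (Fin n)) (Hd : Type) (b : Config S → Config S → ℝ) :
    EnergyTerm (Fin n ⊕ (S ⊕ Hd)) where
  support := S.disjSum ((Finset.univ : Finset S).disjSum ∅)
  energy z := b (fun i => z (Sum.inl i)) fun i => z (Sum.inr (Sum.inl i))
  dependsOn z z' h := by
    have h1 : (fun i : S => z (Sum.inl i)) = fun i : S => z' (Sum.inl i) :=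
      funext fun i => h _ (by simp)
    have h2 : (fun i : S => z (Sum.inr (Sum.inl i))) = fun i : S => z' (Sum.inr (Sum.inl i)) :=
      funext fun i => h _ (by simp)
    simp only [h1, h2]

theorem Represents.gate_mulVec {n k N : ℕ} {Hd : Type} [Fintype Hd] [DecidableEq Hd]
    {l : List (EnergyTerm (Fin n ⊕ Hd))} {φ : Config (Fin n) → ℂ} (h : Represents k N Hd l φ)
    {A : QubitOp n} {S : Finset (Fin n)} (hS : S.card ≤ k) (b : Config S → Config S → ℝ)
    (hA : ∀ x y, A x y = if ∀ i, i ∉ S → x i = y i then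
      ((Real.exp (-b (fun i => x i) (fun i => y i)) : ℝ) : ℂ) else 0) :
    Represents k (N + 1) (S ⊕ Hd)
      (gateTerm S Hd b :: l.map (EnergyTerm.map (freshBits S Hd))) (A.mulVec φ) := by
  refine ⟨?_, ?_, ?_, ?_, ?_, ?_⟩
  · simp [h.length_eq]
  · rw [Fintype.card_sum, Fintype.card_coe]
    linarith [h.card_le]
  · intro t ht
    rcases List.mem_cons.1 ht with rfl | ht
    · change (S.disjSum _).card ≤ _
      rw [Finset.card_disjSum, Finset.card_disjSum, Finset.card_univ, Fintype.card_coe,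
        Finset.card_empty]
      omega
    · obtain ⟨t', ht', rfl⟩ := List.mem_map.1 ht
      exact (Finset.card_map _).trans_le (h.isLocal t' ht')
  · intro i
    rw [EnergyTerm.degree_cons]
    by_cases hi : i ∈ S
    · have : (Sum.inl i : Fin n ⊕ (S ⊕ Hd)) ∉ Set.range (freshBits S Hd) := by
        rintro ⟨j | h', hj⟩
        · by_cases hjS : j ∈ S
          · simp [freshBits_inl_of_mem Hd hjS] at hj
          · rw [freshBits_inl_of_notMem Hd hjS] at hj
            exact hjS (Sum.inl_injective hj ▸ hi)
        · simp [freshBits_inr] at hj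
      rw [EnergyTerm.degree_map_of_notMem_range _ _ this]
      split_ifs <;> omega
    · have h1 := h.degree_inl i
      rw [← EnergyTerm.degree_map (freshBits S Hd), freshBits_inl_of_notMem Hd hi] at h1
      rw [if_neg]
      · exact h1
      · simp [gateTerm, hi]
  · rintro (⟨i, hi⟩ | h')
    · have h1 := h.degree_inl i
      rw [← EnergyTerm.degree_map (freshBits S Hd), freshBits_inl_of_mem Hd hi] at h1
      rw [EnergyTerm.degree_cons]
      split_ifs <;> omega
    · have h1 := h.degree_inr h'
      rw [← EnergyTerm.degree_map (freshBits S Hd)] at h1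
      rw [EnergyTerm.degree_cons, if_neg]
      · exact h1
      · simp [gateTerm, Finset.inr_mem_disjSum]
  · intro x
    rw [Matrix.mulVec, dotProduct]
    simp only [hA, ite_mul, zero_mul]
    rw [sum_ite_agree S x, ← (Equiv.sumArrowEquivProdArrow S Hd Bool).symm.sum_comp,
      Fintype.sum_prod_type, Complex.ofReal_sum]
    refine Finset.sum_congr rfl fun s _ => ?_
    rw [h.apply_eq, ← Complex.ofReal_mul, Finset.mul_sum]
    congr 1
    refine Finset.sum_congr rfl fun g _ => ?_
    have : (Equiv.sumArrowEquivProdArrow S Hd Bool).symm (s, g) = Sum.elim s g := rfl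
    rw [this, ← Real.exp_add, EnergyTerm.total_cons, EnergyTerm.total_map, elim_comp_freshBits,
      restrict_splice, neg_add]
    rfl

/-- A product of `N` positive `k`-local gates, applied to the all-ones vector, has a representation
with `N` terms: the sum over paths of intermediate configurations, with only the bits that a gate
may change stored as hidden bits. -/
theorem exists_represents {n k : ℕ} (gates : List (QubitOp n))
    (hg : ∀ A ∈ gates, IsPositiveGate k A) :
    ∃ (Hd : Type) (_ : Fintype Hd) (_ : DecidableEq Hd) (l : List (EnergyTerm (Fin n ⊕ Hd))),
      Represents k gates.length Hd l (gates.prod.mulVec 1) := by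
  induction gates with
  | nil =>
    exact ⟨Empty, inferInstance, inferInstance, [], by simp, by simp, by simp,
      by simp [EnergyTerm.degree], by simp, by simp [EnergyTerm.total]⟩
  | cons A gates ih =>
    obtain ⟨Hd, _, _, l, hl⟩ := ih fun A' hA' => hg A' (List.mem_cons_of_mem _ hA')
    obtain ⟨S, hS, b, hb⟩ := hg A List.mem_cons_self
    have h := hl.gate_mulVec hS b hb
    rw [Matrix.mulVec_mulVec, ← List.prod_cons] at h
    exact ⟨S ⊕ Hd, inferInstance, inferInstance, _, h⟩

/-- The Born distribution of a represented vector is the visible marginal of a Gibbs distribution: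
two copies of the hidden bits are coupled to the same visible bits. -/
theorem Represents.exists_gibbsMarginal {n k N : ℕ} {Hd : Type} [Fintype Hd] [DecidableEq Hd]
    {l : List (EnergyTerm (Fin n ⊕ Hd))} {φ : Config (Fin n) → ℂ} (h : Represents k N Hd l φ) :
    ∃ (m : ℕ) (G : ClassicalHamiltonian (Fin n ⊕ Fin m)),
      m ≤ k * (2 * N) ∧ G.numTerms = 2 * N ∧ G.IsLocal (2 * k) ∧ (∀ v, G.degree v ≤ 2) ∧
      ∀ x, G.gibbsMarginal x = ‖φ x‖ ^ 2 / ∑ y, ‖φ y‖ ^ 2 := by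
  let e : Hd ⊕ Hd ≃ Fin (Fintype.card (Hd ⊕ Hd)) := Fintype.equivFin _
  let ρ₁ : Fin n ⊕ Hd ↪ Fin n ⊕ Fin (Fintype.card (Hd ⊕ Hd)) :=
    ⟨Sum.map id (e ∘ Sum.inl), Function.injective_id.sumMap (e.injective.comp Sum.inl_injective)⟩
  let ρ₂ : Fin n ⊕ Hd ↪ Fin n ⊕ Fin (Fintype.card (Hd ⊕ Hd)) :=
    ⟨Sum.map id (e ∘ Sum.inr), Function.injective_id.sumMap (e.injective.comp Sum.inr_injective)⟩
  have hρ₁ : ∀ g : Hd, (Sum.inr (e (Sum.inr g)) : Fin n ⊕ Fin _) ∉ Set.range ρ₁ := by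
    rintro g ⟨i | g', hi⟩
    · simp [ρ₁] at hi
    · simp [ρ₁] at hi
  have hρ₂ : ∀ g : Hd, (Sum.inr (e (Sum.inl g)) : Fin n ⊕ Fin _) ∉ Set.range ρ₂ := by
    rintro g ⟨i | g', hi⟩
    · simp [ρ₂] at hi
    · simp [ρ₂] at hi
  let l' := l.map (EnergyTerm.map ρ₁) ++ l.map (EnergyTerm.map ρ₂)
  have hdeg : ∀ v, EnergyTerm.degree l' v =
      EnergyTerm.degree (l.map (EnergyTerm.map ρ₁)) v +
        EnergyTerm.degree (l.map (EnergyTerm.map ρ₂)) v :=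
    fun v => EnergyTerm.degree_append _ _ v
  have hweight : ∀ x, ∑ g, Real.exp (-(EnergyTerm.toHamiltonian l').energy (Sum.elim x g)) =
      ‖φ x‖ ^ 2 := by
    intro x
    rw [h.apply_eq, Complex.norm_real, Real.norm_eq_abs, sq_abs, sq, Finset.sum_mul_sum,
      ← Fintype.sum_prod_type',
      ← ((Equiv.sumArrowEquivProdArrow Hd Hd Bool).symm.trans (e.arrowCongr (Equiv.refl _))).sum_comp]
    refine Finset.sum_congr rfl fun g _ => ?_
    have h1 : (Sum.elim x (((Equiv.sumArrowEquivProdArrow Hd Hd Bool).symm.trans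
        (e.arrowCongr (Equiv.refl _))) g) : Config (Fin n ⊕ Fin _)) ∘ ρ₁ = Sum.elim x g.1 := by
      funext v
      rcases v with i | v <;> simp [ρ₁, Equiv.sumArrowEquivProdArrow]
    have h2 : (Sum.elim x (((Equiv.sumArrowEquivProdArrow Hd Hd Bool).symm.trans
        (e.arrowCongr (Equiv.refl _))) g) : Config (Fin n ⊕ Fin _)) ∘ ρ₂ = Sum.elim x g.2 := by
      funext v
      rcases v with i | v <;> simp [ρ₂, Equiv.sumArrowEquivProdArrow]
    rw [EnergyTerm.energy_toHamiltonian, EnergyTerm.total_append, EnergyTerm.total_map,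
      EnergyTerm.total_map, h1, h2, neg_add, Real.exp_add]
  refine ⟨_, EnergyTerm.toHamiltonian l', ?_, ?_, ?_, ?_, ?_⟩
  · rw [Fintype.card_sum]
    linarith [h.card_le]
  · change l'.length = _
    simp only [l', List.length_append, List.length_map, h.length_eq]
    ring
  · intro a
    change (l'.get a).support.card ≤ _
    rcases List.mem_append.1 (List.get_mem l' a) with ha | ha
    all_goals
      obtain ⟨t, ht, hta⟩ := List.mem_map.1 ha
      rw [← hta]
      exact (Finset.card_map _).trans_le (h.isLocal t ht)
  · intro v
    rw [EnergyTerm.degree_toHamiltonian, hdeg]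
    rcases v with i | g
    · have h1 := h.degree_inl i
      have h2 := h.degree_inl i
      rw [← EnergyTerm.degree_map ρ₁] at h1
      rw [← EnergyTerm.degree_map ρ₂] at h2
      exact add_le_add h1 h2
    · obtain ⟨g | g, rfl⟩ := e.surjective g
      · rw [EnergyTerm.degree_map_of_notMem_range _ _ (hρ₂ g)]
        exact (EnergyTerm.degree_map ρ₁ l (Sum.inr g)).trans_le (h.degree_inr g)
      · rw [EnergyTerm.degree_map_of_notMem_range _ _ (hρ₁ g), zero_add]
        exact (EnergyTerm.degree_map ρ₂ l (Sum.inr g)).trans_le (h.degree_inr g)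
  · intro x
    simp only [ClassicalHamiltonian.gibbsMarginal, ClassicalHamiltonian.gibbs]
    rw [← Finset.sum_div, hweight, ClassicalHamiltonian.partitionFunction,
      ← (Equiv.sumArrowEquivProdArrow (Fin n) (Fin _) Bool).symm.sum_comp, Fintype.sum_prod_type]
    congr 1
    exact Finset.sum_congr rfl fun y _ => hweight y

/-! ### Total variation distance of Born distributions -/

section Born

variable {ι : Type} [Fintype ι]

/-- Two Born distributions differ in total variation by at most `‖a - b‖ ‖a + b‖ / 2`, since
`|z|² - |w|² = Re (z - w)(z + w)̄` for complex numbers. -/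
theorem tvDist_born_le (a b : EuclideanSpace ℂ ι) :
    tvDist (fun x => ‖a x‖ ^ 2) (fun x => ‖b x‖ ^ 2) ≤ 1 / 2 * (‖a - b‖ * ‖a + b‖) := by
  have h1 : ∀ z w : ℂ, |‖z‖ ^ 2 - ‖w‖ ^ 2| ≤ ‖z - w‖ * ‖z + w‖ := fun z w => by
    have : ‖z‖ ^ 2 - ‖w‖ ^ 2 = ⟪z - w, z + w⟫_ℝ := by
      rw [inner_add_right, inner_sub_left, inner_sub_left, real_inner_self_eq_norm_sq,
        real_inner_self_eq_norm_sq, real_inner_comm]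
      ring
    rw [this]
    exact abs_real_inner_le_norm _ _
  rw [tvDist]
  refine mul_le_mul_of_nonneg_left ?_ (by norm_num)
  refine (Finset.sum_le_sum fun x _ => h1 (a x) (b x)).trans ?_
  rw [EuclideanSpace.norm_eq, EuclideanSpace.norm_eq]
  exact Real.sum_mul_le_sqrt_mul_sqrt _ _ _

/-- If a multiple of `φ` is within `r` of `η ψ`, then the normalized Born distribution of `φ` is
within `2 r / η` of that of the unit vector `ψ`. -/
theorem tvDist_born_normalized_le {φ ψ : EuclideanSpace ℂ ι} {α η r : ℝ} (hα : 0 < α) (hη : 0 < η)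
    (hψ : ‖ψ‖ = 1) (hr : r < η) (h : ‖(α : ℂ) • φ - (η : ℂ) • ψ‖ ≤ r) :
    tvDist (fun x => ‖φ x‖ ^ 2 / ∑ y, ‖φ y‖ ^ 2) (fun x => ‖ψ x‖ ^ 2) ≤ 2 * r / η := by
  have hηψ : ‖(η : ℂ) • ψ‖ = η := by
    rw [norm_smul, hψ, Complex.norm_real, Real.norm_of_nonneg hη.le, mul_one]
  have hu : |‖(α : ℂ) • φ‖ - η| ≤ r := by
    have := abs_norm_sub_norm_le ((α : ℂ) • φ) ((η : ℂ) • ψ)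
    rw [hηψ] at this
    exact this.trans h
  have hαφ : ‖(α : ℂ) • φ‖ = α * ‖φ‖ := by
    rw [norm_smul, Complex.norm_real, Real.norm_of_nonneg hα.le]
  have hφ : 0 < ‖φ‖ := by
    rw [hαφ] at hu
    have := (abs_le.1 hu).1
    by_contra hneg
    have : α * ‖φ‖ ≤ 0 := mul_nonpos_of_nonneg_of_nonpos hα.le (not_lt.1 hneg)
    linarith
  set a : EuclideanSpace ℂ ι := ((‖φ‖⁻¹ : ℝ) : ℂ) • φ with ha
  have ha1 : ‖a‖ = 1 := by
    rw [ha, norm_smul, Complex.norm_real, Real.norm_of_nonneg (inv_nonneg.2 hφ.le),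
      inv_mul_cancel₀ hφ.ne']
  have hax : ∀ x, ‖φ x‖ ^ 2 / ∑ y, ‖φ y‖ ^ 2 = ‖a x‖ ^ 2 := fun x => by
    rw [← EuclideanSpace.norm_sq_eq, ha, PiLp.smul_apply, norm_smul, Complex.norm_real,
      Real.norm_of_nonneg (inv_nonneg.2 hφ.le), mul_pow, inv_pow]
    field_simp
  -- `η (a - ψ)` is the sum of the error `α φ - η ψ` and of the error in the normalization.
  have hdiff : ‖a - ψ‖ ≤ 2 * r / η := by
    have key : (η : ℂ) • (a - ψ) =
        ((α : ℂ) • φ - (η : ℂ) • ψ) + ((η - α * ‖φ‖ : ℝ) : ℂ) • a := by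
      have : (α : ℂ) • φ = ((α * ‖φ‖ : ℝ) : ℂ) • a := by
        rw [ha, smul_smul, ← Complex.ofReal_mul, mul_assoc, mul_inv_cancel₀ hφ.ne', mul_one]
      rw [this, Complex.ofReal_sub, sub_smul, smul_sub]
      abel
    have h2 : η * ‖a - ψ‖ = ‖(η : ℂ) • (a - ψ)‖ := by
      rw [norm_smul, Complex.norm_real, Real.norm_of_nonneg hη.le]
    have h3 : ‖((η - α * ‖φ‖ : ℝ) : ℂ) • a‖ ≤ r := by
      rw [norm_smul, ha1, mul_one, Complex.norm_real, Real.norm_eq_abs, abs_sub_comm, ← hαφ]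
      exact hu
    rw [le_div_iff₀ hη, mul_comm, h2, key]
    exact (norm_add_le _ _).trans (by linarith)
  simp only [hax]
  refine (tvDist_born_le a ψ).trans ?_
  have h4 : ‖a + ψ‖ ≤ 2 := (norm_add_le _ _).trans (by rw [ha1, hψ]; norm_num)
  nlinarith [norm_nonneg (a - ψ)]

end Born

/-! ### Positive gates approximating entrywise non-negative ones -/

section Gates

open scoped ComplexOrder

variable {n : ℕ}

/-- Adding a small multiple of the operator with all-ones kernel on `S` makes the kernel on `S`
strictly positive. -/
theorem exists_isPositiveGate_add {k : ℕ} {A : QubitOp n} {S : Finset (Fin n)} (hS : S.card ≤ k)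
    (hA : SupportedOn S A) (hpos : ∀ x y, 0 ≤ A x y) :
    ∃ K : QubitOp n, ∀ δ : ℝ, 0 < δ → IsPositiveGate k (A + (δ : ℂ) • K) := by
  obtain ⟨B, hB⟩ := hA
  refine ⟨Matrix.of fun x y => if ∀ i, i ∉ S → x i = y i then 1 else 0, fun δ hδ =>
    ⟨S, hS, fun u v => -Real.log ((B u v).re + δ), fun x y => ?_⟩⟩
  have h1 := hpos x y
  rw [Matrix.add_apply, Matrix.smul_apply, Matrix.of_apply]
  rw [hB] at h1 ⊢
  split_ifs with h
  · rw [if_pos h] at h1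
    obtain ⟨hre, him⟩ := Complex.nonneg_iff.1 h1
    rw [neg_neg, Real.exp_log (by linarith)]
    apply Complex.ext
    · simp
    · simp [him.symm]
  · simp

/-- A product of entrywise non-negative local gates is a limit of products of positive gates. -/
theorem exists_positive_gates_approx {k : ℕ} (gates : List (QubitOp n))
    (hg : ∀ A ∈ gates, ∃ S : Finset (Fin n), S.card ≤ k ∧ SupportedOn S A ∧ ∀ x y, 0 ≤ A x y)
    {r : ℝ} (hr : 0 < r) :
    ∃ gates' : List (QubitOp n), gates'.length = gates.length ∧
      (∀ A ∈ gates', IsPositiveGate k A) ∧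
      ‖Matrix.toEuclideanCLM (𝕜 := ℂ) gates'.prod -
        Matrix.toEuclideanCLM (𝕜 := ℂ) gates.prod‖ ≤ r := by
  have hK : ∀ A : QubitOp n, ∃ K : QubitOp n, A ∈ gates → ∀ δ : ℝ, 0 < δ →
      IsPositiveGate k (A + (δ : ℂ) • K) := fun A => by
    by_cases h : A ∈ gates
    · obtain ⟨S, hS, hA, hpos⟩ := hg A h
      obtain ⟨K, hK⟩ := exists_isPositiveGate_add hS hA hpos
      exact ⟨K, fun _ => hK⟩
    · exact ⟨0, fun h' => absurd h' h⟩
  choose K hK using hK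
  have hcont : Continuous fun δ : ℝ => (gates.map fun A => Matrix.toEuclideanCLM (𝕜 := ℂ) A +
      (δ : ℂ) • Matrix.toEuclideanCLM (𝕜 := ℂ) (K A)).prod :=
    continuous_list_prod _ fun A _ => by fun_prop
  have hmap : ∀ δ : ℝ, Matrix.toEuclideanCLM (𝕜 := ℂ) (gates.map fun A => A + (δ : ℂ) • K A).prod =
      (gates.map fun A => Matrix.toEuclideanCLM (𝕜 := ℂ) A +
      (δ : ℂ) • Matrix.toEuclideanCLM (𝕜 := ℂ) (K A)).prod := fun δ => by
    rw [map_list_prod, List.map_map]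
    simp only [Function.comp_def, map_add, map_smul]
  obtain ⟨d, hd, hball⟩ := Metric.continuous_iff.1 hcont 0 r hr
  have h1 := hball (d / 2) (by rw [Real.dist_eq, sub_zero, abs_of_pos (half_pos hd)]; linarith)
  rw [← hmap, ← hmap, dist_eq_norm] at h1
  refine ⟨gates.map fun A => A + ((d / 2 : ℝ) : ℂ) • K A, List.length_map _, ?_, ?_⟩
  · intro A' hA'
    obtain ⟨A, hA, rfl⟩ := List.mem_map.1 hA'
    exact hK A hA _ (half_pos hd)
  · simpa using h1.le

theorem norm_entry_le {ι : Type} [Fintype ι] [DecidableEq ι] (A : Matrix ι ι ℂ) (x y : ι) :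
    ‖A x y‖ ≤ ‖Matrix.toEuclideanCLM (𝕜 := ℂ) A‖ := by
  have h1 : A x y = (Matrix.toEuclideanCLM (𝕜 := ℂ) A (EuclideanSpace.single y 1)) x := by
    rw [Matrix.ofLp_toEuclideanCLM]
    simp
  rw [h1]
  refine (PiLp.norm_apply_le _ x).trans ((ContinuousLinearMap.le_opNorm _ _).trans ?_)
  simp

/-- The second-order Taylor polynomial of `exp (-(t / 2) A)`. -/
noncomputable def halfStepGate (t : ℝ) (A : QubitOp n) : QubitOp n :=
  1 + (-(t / 2 : ℝ) : ℂ) • A + (2⁻¹ : ℂ) • ((-(t / 2 : ℝ) : ℂ) • A) ^ 2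

theorem SupportedOn.halfStepGate {S : Finset (Fin n)} {A : QubitOp n} (h : SupportedOn S A)
    (t : ℝ) : SupportedOn S (halfStepGate t A) := by
  have h1 := h.smul (-(t / 2 : ℝ) : ℂ)
  rw [_root_.halfStepGate, sq]
  exact ((SupportedOn.one S).add h1).add ((h1.mul h1).smul _)

/-- The gate is half of `1 + (1 - (t / 2) A)²`, and `1 - (t / 2) A` is entrywise non-negative for
small `t` when `A` is stoquastic. -/
theorem halfStepGate_nonneg {A : QubitOp n} (hA : A.IsHermitian)
    (hst : ∀ x y, x ≠ y → (A x y).im = 0 ∧ (A x y).re ≤ 0) {t J : ℝ} (ht : 0 ≤ t)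
    (hJ : ‖Matrix.toEuclideanCLM (𝕜 := ℂ) A‖ ≤ J) (htJ : t * J ≤ 2) (x y : Config (Fin n)) :
    0 ≤ halfStepGate t A x y := by
  have hB : ∀ x y, 0 ≤ ((1 : QubitOp n) + (-(t / 2 : ℝ) : ℂ) • A) x y := by
    intro x y
    rw [Matrix.add_apply, Matrix.smul_apply, Complex.nonneg_iff]
    by_cases hxy : x = y
    · subst hxy
      have him : (A x x).im = 0 := by
        have := congrArg Complex.im (hA.apply x x)
        simp only [RCLike.star_def, Complex.conj_im] at this
        linarith
      have hre : (A x x).re ≤ J :=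
        (Complex.re_le_norm _).trans ((norm_entry_le A x x).trans hJ)
      constructor
      · simp
        nlinarith
      · simp [him]
    · obtain ⟨him, hre⟩ := hst x y hxy
      constructor
      · simp [Matrix.one_apply_ne hxy]
        nlinarith
      · simp [Matrix.one_apply_ne hxy, him]
  have h1 : halfStepGate t A = (2⁻¹ : ℂ) • (1 + (1 + (-(t / 2 : ℝ) : ℂ) • A) *
      (1 + (-(t / 2 : ℝ) : ℂ) • A)) := by
    rw [halfStepGate]
    generalize (-(t / 2 : ℝ) : ℂ) • A = Z
    have : (1 : QubitOp n) + (1 + Z) * (1 + Z) = (2 : ℂ) • (1 + Z) + Z ^ 2 := by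
      rw [two_smul]; noncomm_ring
    rw [this, smul_add, smul_smul]
    norm_num
  rw [h1, Matrix.smul_apply, Matrix.add_apply, smul_eq_mul]
  refine mul_nonneg (by simp) (add_nonneg ?_ ?_)
  · rw [Matrix.one_apply]
    split_ifs <;> simp
  · rw [Matrix.mul_apply]
    exact Finset.sum_nonneg fun z _ => mul_nonneg (hB x z) (hB z y)

end Gates

/-! ### Spectral estimates -/

/-- An operator with an orthonormal eigenbasis contracts every vector supported on eigenvectors of
small eigenvalue. -/
theorem norm_apply_le_of_eigenbasis {ι E : Type*} [Fintype ι] [NormedAddCommGroup E]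
    [InnerProductSpace ℂ E] (v : OrthonormalBasis ι ℂ E) (T : E →L[ℂ] E) {μ : ι → ℂ}
    (hT : ∀ i, T (v i) = μ i • v i) {c : ℝ} (hc : 0 ≤ c) {w : E}
    (hw : ∀ i, ⟪v i, w⟫_ℂ = 0 ∨ ‖μ i‖ ≤ c) : ‖T w‖ ≤ c * ‖w‖ := by
  classical
  have h1 : ∀ i, ⟪v i, T w⟫_ℂ = μ i * ⟪v i, w⟫_ℂ := fun i => by
    conv_lhs => rw [← v.sum_repr' w]
    rw [map_sum, inner_sum, Finset.sum_eq_single i]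
    · rw [map_smul, hT, inner_smul_right, inner_smul_right, v.inner_eq_ite, if_pos rfl]
      ring
    · intro j _ hj
      rw [map_smul, hT, inner_smul_right, inner_smul_right, v.inner_eq_ite, if_neg hj.symm]
      ring
    · simp
  refine abs_le_of_sq_le_sq' ?_ (by positivity) |>.2
  rw [mul_pow, ← v.sum_sq_norm_inner_right, ← v.sum_sq_norm_inner_right w, Finset.mul_sum]
  refine Finset.sum_le_sum fun i _ => ?_
  rw [h1, norm_mul, mul_pow]
  rcases hw i with h | h
  · simp [h]
  · gcongr

theorem pow_apply_of_eigen {E : Type*} [NormedAddCommGroup E] [NormedSpace ℂ E] {T : E →L[ℂ] E}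
    {μ : ℂ} {v : E} (h : T v = μ • v) (p : ℕ) : (T ^ p) v = μ ^ p • v := by
  induction p with
  | zero => simp
  | succ p ih =>
    rw [pow_succ]
    change (T ^ p) (T v) = _
    rw [h, map_smul, ih, smul_smul, pow_succ']

/-- The eigenvalue of the second-order Taylor polynomial of `exp (-t H)` at energy `E`. -/
noncomputable def taylorEigenvalue (t E : ℝ) : ℝ := 1 - t * E + (t * E) ^ 2 / 2

theorem taylorEigenvalue_pos (t E : ℝ) : 0 < taylorEigenvalue t E := by
  rw [taylorEigenvalue]
  nlinarith [sq_nonneg (t * E - 1)]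

theorem one_half_le_taylorEigenvalue (t E : ℝ) : 1 / 2 ≤ taylorEigenvalue t E := by
  rw [taylorEigenvalue]
  nlinarith [sq_nonneg (t * E - 1)]

/-- An energy gap `D` makes the Taylor polynomial contract by the factor `exp (-t D / 4)`. -/
theorem taylorEigenvalue_le_of_add_le {t E E' D R : ℝ} (ht : 0 ≤ t) (hD : 0 ≤ D) (hR : t * R ≤ 1 / 2)
    (hE : |E| ≤ R) (hE' : |E'| ≤ R) (h : E + D ≤ E') :
    taylorEigenvalue t E' ≤ taylorEigenvalue t E * Real.exp (-(t * D / 4)) := by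
  have hb : ∀ {e : ℝ}, |e| ≤ R → |t * e| ≤ 1 / 2 := fun {e} he => by
    rw [abs_mul, abs_of_nonneg ht]
    exact (mul_le_mul_of_nonneg_left he ht).trans hR
  obtain ⟨h1, h2⟩ := abs_le.1 (hb hE)
  obtain ⟨h3, h4⟩ := abs_le.1 (hb hE')
  have h5 : t * E + t * D ≤ t * E' := by nlinarith
  have h6 : 0 ≤ t * D := by positivity
  have h7 : taylorEigenvalue t E' ≤ taylorEigenvalue t E - t * D / 2 := by
    rw [taylorEigenvalue, taylorEigenvalue]
    nlinarith
  have h8 : taylorEigenvalue t E ≤ 2 := by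
    rw [taylorEigenvalue]
    nlinarith
  have h9 := Real.add_one_le_exp (-(t * D / 4))
  nlinarith [taylorEigenvalue_pos t E]

/-- The second-order Taylor polynomial of `exp (-t A)`. -/
noncomputable def taylorStep {n : ℕ} (t : ℝ) (A : QubitOp n) : QubitSpace n →L[ℂ] QubitSpace n :=
  1 + Matrix.toEuclideanCLM (𝕜 := ℂ) (((-t : ℝ) : ℂ) • A) +
    (2⁻¹ : ℂ) • Matrix.toEuclideanCLM (𝕜 := ℂ) (((-t : ℝ) : ℂ) • A) ^ 2

theorem taylorStep_apply {n : ℕ} (t : ℝ) {A : QubitOp n} {E : ℝ} {v : QubitSpace n}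
    (hv : Matrix.toEuclideanCLM (𝕜 := ℂ) A v = (E : ℂ) • v) :
    taylorStep t A v = (taylorEigenvalue t E : ℂ) • v := by
  have h1 : Matrix.toEuclideanCLM (𝕜 := ℂ) (((-t : ℝ) : ℂ) • A) v = ((-t * E : ℝ) : ℂ) • v := by
    rw [map_smul, smul_apply, hv, smul_smul, Complex.ofReal_mul]
  rw [taylorStep]
  generalize Matrix.toEuclideanCLM (𝕜 := ℂ) (((-t : ℝ) : ℂ) • A) = X at h1
  change v + X v + (2⁻¹ : ℂ) • (X ^ 2) v = _
  rw [pow_apply_of_eigen h1, h1, taylorEigenvalue, smul_smul]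
  nth_rewrite 1 [← one_smul ℂ v]
  rw [← add_smul, ← add_smul]
  congr 1
  push_cast
  ring

theorem norm_plusState (n : ℕ) : ‖plusState n‖ = 1 := by
  rw [EuclideanSpace.norm_eq, Real.sqrt_eq_one]
  simp only [plusState, Complex.norm_real]
  simp

/-! ### Energies, gap and ground space -/

namespace LocalHamiltonian

variable {n k L : ℕ} (H : LocalHamiltonian n k L)

theorem isHermitian_total : H.total.IsHermitian :=
  isSelfAdjoint_sum _ fun a _ => H.isHermitian a

theorem norm_total_le {H : LocalHamiltonian n k L} {J : ℝ} (hJ : H.TermNormLE J) :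
    ‖Matrix.toEuclideanCLM (𝕜 := ℂ) H.total‖ ≤ L * J := by
  rw [total, map_sum]
  refine (norm_sum_le _ _).trans ((Finset.sum_le_sum fun a _ => hJ a).trans ?_)
  simp

theorem mem_energies_iff {E : ℝ} : E ∈ H.energies ↔
    ∃ v : QubitSpace n, v ≠ 0 ∧ Matrix.toEuclideanCLM (𝕜 := ℂ) H.total v = (E : ℂ) • v := by
  constructor
  · intro h
    obtain ⟨v, hv⟩ := Module.End.HasEigenvalue.exists_hasEigenvector h
    exact ⟨v, hv.2, hv.apply_eq_smul⟩
  · rintro ⟨v, h0, hv⟩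
    exact Module.End.hasEigenvalue_of_hasEigenvector (x := v)
      ⟨Module.End.mem_eigenspace_iff.2 hv, h0⟩

theorem abs_le_of_mem_energies {H : LocalHamiltonian n k L} {J : ℝ} (hJ : H.TermNormLE J) {E : ℝ}
    (hE : E ∈ H.energies) : |E| ≤ L * J := by
  obtain ⟨v, h0, hv⟩ := H.mem_energies_iff.1 hE
  have h1 := (ContinuousLinearMap.le_opNorm (Matrix.toEuclideanCLM (𝕜 := ℂ) H.total) v).trans
    (mul_le_mul_of_nonneg_right (norm_total_le hJ) (norm_nonneg v))
  rw [hv, norm_smul, Complex.norm_real, Real.norm_eq_abs] at h1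
  exact le_of_mul_le_mul_right h1 (norm_pos_iff.2 h0)

theorem bddBelow_energies {H : LocalHamiltonian n k L} {J : ℝ} (hJ : H.TermNormLE J) :
    BddBelow H.energies :=
  ⟨-(L * J), fun _ hE => (abs_le.1 (abs_le_of_mem_energies hJ hE)).1⟩

theorem HasGap.pos {H : LocalHamiltonian n k L} {Δ : ℝ} (h : H.HasGap Δ) : 0 < Δ := by
  have := h.1.2
  linarith

theorem abs_groundEnergy_le {H : LocalHamiltonian n k L} {J Δ : ℝ} (hJ : H.TermNormLE J)
    (hΔ : H.HasGap Δ) : |H.groundEnergy| ≤ L * J := by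
  refine abs_le.2 ⟨le_csInf ⟨_, hΔ.1.1⟩ fun E hE => (abs_le.1 (abs_le_of_mem_energies hJ hE)).1, ?_⟩
  have h1 := (abs_le.1 (abs_le_of_mem_energies hJ hΔ.1.1)).2
  linarith [hΔ.pos]

theorem HasGap.le {H : LocalHamiltonian n k L} {J Δ : ℝ} (hΔ : H.HasGap Δ) (hJ : H.TermNormLE J) :
    Δ ≤ 2 * (L * J) := by
  have h1 := (abs_le.1 (abs_le_of_mem_energies hJ hΔ.1.1)).2
  have h2 := (abs_le.1 (abs_groundEnergy_le hJ hΔ)).1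
  linarith

theorem HasGap.energy_cases {H : LocalHamiltonian n k L} {J Δ : ℝ} (hΔ : H.HasGap Δ)
    (hJ : H.TermNormLE J) {E : ℝ} (hE : E ∈ H.energies) :
    E = H.groundEnergy ∨ H.groundEnergy + Δ ≤ E := by
  rcases (csInf_le (bddBelow_energies hJ) hE).eq_or_lt with h | h
  · exact Or.inl h.symm
  · exact Or.inr (hΔ.2 ⟨hE, h⟩)

theorem re_inner_plusState_groundProj :
    (⟪plusState n, H.groundProj (plusState n)⟫_ℂ).re = ‖H.groundProj (plusState n)‖ ^ 2 := by
  rw [groundProj, ← Submodule.inner_starProjection_left_eq_right]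
  exact Submodule.re_inner_starProjection_eq_normSq H.groundSpace (plusState n)

theorem overlap_eq : H.overlap = ‖H.groundProj (plusState n)‖ := by
  rw [overlap, re_inner_plusState_groundProj, Real.sqrt_sq (norm_nonneg _)]

theorem overlap_le_one : H.overlap ≤ 1 := by
  rw [overlap_eq, ← norm_plusState n]
  exact Submodule.norm_starProjection_apply_le _ _

theorem overlap_smul_groundState (h : 0 < H.overlap) :
    (H.overlap : ℂ) • H.groundState = H.groundProj (plusState n) := by
  rw [groundState, smul_smul, ← Complex.ofReal_mul, mul_inv_cancel₀ h.ne', Complex.ofReal_one,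
    one_smul]

theorem norm_groundState (h : 0 < H.overlap) : ‖H.groundState‖ = 1 := by
  rw [groundState, norm_smul, Complex.norm_real, Real.norm_of_nonneg (inv_nonneg.2 h.le),
    ← overlap_eq, inv_mul_cancel₀ h.ne']

theorem exists_eigenbasis : ∃ (v : OrthonormalBasis (Config (Fin n)) ℂ (QubitSpace n))
    (e : Config (Fin n) → ℝ), ∀ i, e i ∈ H.energies ∧
      Matrix.toEuclideanCLM (𝕜 := ℂ) H.total (v i) = (e i : ℂ) • v i := by
  refine ⟨H.isHermitian_total.eigenvectorBasis, H.isHermitian_total.eigenvalues, fun i => ?_⟩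
  have hv : Matrix.toEuclideanCLM (𝕜 := ℂ) H.total (H.isHermitian_total.eigenvectorBasis i) =
      (H.isHermitian_total.eigenvalues i : ℂ) • H.isHermitian_total.eigenvectorBasis i := by
    apply WithLp.ofLp_injective 2
    rw [Matrix.ofLp_toEuclideanCLM, H.isHermitian_total.mulVec_eigenvectorBasis i]
    rfl
  exact ⟨H.mem_energies_iff.2 ⟨_, H.isHermitian_total.eigenvectorBasis.orthonormal.ne_zero i, hv⟩, hv⟩

theorem norm_taylorStep_le {H : LocalHamiltonian n k L} {J Δ t : ℝ} (hJ : H.TermNormLE J)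
    (hΔ : H.HasGap Δ) (ht : 0 ≤ t) (hs : t * (L * J) ≤ 1 / 2) :
    ‖taylorStep t H.total‖ ≤ taylorEigenvalue t H.groundEnergy := by
  obtain ⟨v, e, he⟩ := H.exists_eigenbasis
  refine ContinuousLinearMap.opNorm_le_bound _ (taylorEigenvalue_pos _ _).le fun w =>
    norm_apply_le_of_eigenbasis v _ (fun i => taylorStep_apply t (he i).2)
      (taylorEigenvalue_pos _ _).le fun i => Or.inr ?_
  have h1 := taylorEigenvalue_le_of_add_le ht le_rfl hs (abs_groundEnergy_le hJ hΔ)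
    (abs_le_of_mem_energies hJ (he i).1)
    ((add_zero _).trans_le (csInf_le (bddBelow_energies hJ) (he i).1))
  rw [Complex.norm_real, Real.norm_of_nonneg (taylorEigenvalue_pos _ _).le]
  simpa using h1

theorem re_inner_plusState_groundState (h : 0 < H.overlap) :
    (⟪plusState n, H.groundState⟫_ℂ).re = H.overlap := by
  rw [groundState, inner_smul_right, Complex.re_ofReal_mul, re_inner_plusState_groundProj,
    ← overlap_eq, sq, inv_mul_cancel_left₀ h.ne']

/-- Powers of the Taylor step converge to the ground space projection, at a rate set by the gap. -/
theorem norm_taylorStep_pow_sub_le {H : LocalHamiltonian n k L} {J Δ t : ℝ} (hJ : H.TermNormLE J)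
    (hΔ : H.HasGap Δ) (ht : 0 ≤ t) (hs : t * (L * J) ≤ 1 / 2) (p : ℕ) :
    ‖(taylorStep t H.total ^ p) (plusState n) -
        ((taylorEigenvalue t H.groundEnergy ^ p : ℝ) : ℂ) • H.groundProj (plusState n)‖ ≤
      taylorEigenvalue t H.groundEnergy ^ p * Real.exp (-(p * t * Δ / 4)) := by
  obtain ⟨v, e, he⟩ := H.exists_eigenbasis
  have hground : (taylorStep t H.total ^ p) (H.groundProj (plusState n)) =
      ((taylorEigenvalue t H.groundEnergy ^ p : ℝ) : ℂ) • H.groundProj (plusState n) := by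
    rw [Complex.ofReal_pow]
    refine pow_apply_of_eigen (taylorStep_apply t ?_) p
    exact Module.End.mem_eigenspace_iff.1
      (Submodule.starProjection_apply_mem H.groundSpace (plusState n))
  have hc : 0 ≤ taylorEigenvalue t H.groundEnergy ^ p * Real.exp (-(p * t * Δ / 4)) :=
    mul_nonneg (pow_nonneg (taylorEigenvalue_pos _ _).le p) (Real.exp_pos _).le
  have hnorm : ‖plusState n - H.groundProj (plusState n)‖ ≤ 1 := by
    rw [← norm_plusState n, groundProj, ← Submodule.starProjection_orthogonal_val]
    exact Submodule.norm_starProjection_apply_le _ _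
  rw [← hground, ← map_sub]
  refine (norm_apply_le_of_eigenbasis v _
    (fun i => pow_apply_of_eigen (taylorStep_apply t (he i).2) p) hc
    (fun i => ?_)).trans (mul_le_of_le_one_right hc hnorm)
  rcases hΔ.energy_cases hJ (he i).1 with h | h
  · left
    have hmem : v i ∈ H.groundSpace := Module.End.mem_eigenspace_iff.2 (by
      have := (he i).2
      rw [h] at this
      exact this)
    exact Submodule.inner_right_of_mem_orthogonal hmem
      (Submodule.sub_starProjection_mem_orthogonal _)
  · right
    have h1 := taylorEigenvalue_le_of_add_le ht hΔ.pos.le hs (abs_groundEnergy_le hJ hΔ)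
      (abs_le_of_mem_energies hJ (he i).1) h
    rw [norm_pow, Complex.norm_real, Real.norm_of_nonneg (taylorEigenvalue_pos _ _).le]
    refine (pow_le_pow_left₀ (taylorEigenvalue_pos _ _).le h1 p).trans (le_of_eq ?_)
    rw [mul_pow, ← Real.exp_nat_mul]
    ring_nf

end LocalHamiltonian

/-! ### The gate sequence of a stoquastic Hamiltonian -/

namespace LocalHamiltonian

variable {n k L : ℕ} (H : LocalHamiltonian n k L)

/-- One palindromic sweep over the terms of `H`, with time step `t`. -/
noncomputable def sweep (t : ℝ) : List (QubitOp n) :=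
  (List.finRange L ++ (List.finRange L).reverse).map fun a => halfStepGate t (H.term a)

/-- One sweep has the same second-order jet in `t` as `exp (-t H)`; both remainders are controlled by
the exponential series of `t L J`. -/
theorem norm_sweep_sub_taylorStep_le {H : LocalHamiltonian n k L} {J t : ℝ} (hJ : H.TermNormLE J)
    (hJ0 : 0 ≤ J) (ht : 0 ≤ t) (hs : t * (L * J) ≤ 1 / 2) :
    ‖Matrix.toEuclideanCLM (𝕜 := ℂ) (H.sweep t).prod - taylorStep t H.total‖ ≤
      (t * (L * J)) ^ 3 := by
  have hX : ∀ a, ‖Matrix.toEuclideanCLM (𝕜 := ℂ) ((-(t / 2 : ℝ) : ℂ) • H.term a)‖ ≤ t / 2 * J := by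
    intro a
    rw [map_smul, norm_smul, norm_neg, Complex.norm_real, Real.norm_of_nonneg (by positivity)]
    exact mul_le_mul_of_nonneg_left (hJ a) (by positivity)
  have h1 := (HasJet.palindrome hX (List.finRange L)).remainder
  have hsum : (2 : ℂ) • ((List.finRange L).map fun a =>
      Matrix.toEuclideanCLM (𝕜 := ℂ) ((-(t / 2 : ℝ) : ℂ) • H.term a)).sum =
      Matrix.toEuclideanCLM (𝕜 := ℂ) (((-t : ℝ) : ℂ) • H.total) := by
    rw [← Fin.sum_univ_def, ← map_sum, ← Finset.smul_sum, ← map_smul, smul_smul, total]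
    congr 2
    push_cast
    ring
  have hprod : ((List.finRange L).map fun a => 1 +
        Matrix.toEuclideanCLM (𝕜 := ℂ) ((-(t / 2 : ℝ) : ℂ) • H.term a) +
        (2⁻¹ : ℂ) • Matrix.toEuclideanCLM (𝕜 := ℂ) ((-(t / 2 : ℝ) : ℂ) • H.term a) ^ 2).prod *
      ((List.finRange L).reverse.map fun a => 1 +
        Matrix.toEuclideanCLM (𝕜 := ℂ) ((-(t / 2 : ℝ) : ℂ) • H.term a) +
        (2⁻¹ : ℂ) • Matrix.toEuclideanCLM (𝕜 := ℂ) ((-(t / 2 : ℝ) : ℂ) • H.term a) ^ 2).prod =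
      Matrix.toEuclideanCLM (𝕜 := ℂ) (H.sweep t).prod := by
    rw [sweep, map_list_prod, List.map_map, List.map_append, List.prod_append]
    have : (⇑(Matrix.toEuclideanCLM (𝕜 := ℂ)) ∘ fun a => halfStepGate t (H.term a)) = fun a => 1 +
        Matrix.toEuclideanCLM (𝕜 := ℂ) ((-(t / 2 : ℝ) : ℂ) • H.term a) +
        (2⁻¹ : ℂ) • Matrix.toEuclideanCLM (𝕜 := ℂ) ((-(t / 2 : ℝ) : ℂ) • H.term a) ^ 2 := funext fun a => by
      rw [Function.comp_apply, halfStepGate, map_add, map_add, map_one,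
        map_smul _ (2⁻¹ : ℂ), map_pow]
    rw [this]
  rw [hsum, hprod, List.length_finRange] at h1
  refine h1.trans ?_
  have h2 : 2 * (L : ℝ) * (t / 2 * J) = t * (L * J) := by ring
  rw [h2]
  have hs0 : 0 ≤ t * (L * J) := by positivity
  have h3 := Real.exp_bound' hs0 (hs.trans (by norm_num)) (n := 3) (by norm_num)
  simp only [Finset.sum_range_succ, Finset.sum_range_zero, Nat.factorial] at h3
  norm_num at h3
  nlinarith [pow_nonneg hs0 3]

open scoped ComplexOrder in
theorem exists_support_of_mem_sweep {H : LocalHamiltonian n k L} (hH : H.IsStoquastic) {J t : ℝ}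
    (hJ : H.TermNormLE J) (ht : 0 ≤ t) (htJ : t * J ≤ 2) {A : QubitOp n} (hA : A ∈ H.sweep t) :
    ∃ S : Finset (Fin n), S.card ≤ k ∧ SupportedOn S A ∧ ∀ x y, 0 ≤ A x y := by
  obtain ⟨a, -, rfl⟩ := List.mem_map.1 hA
  obtain ⟨S, hS, hsupp⟩ := H.isLocal a
  exact ⟨S, hS, hsupp.halfStepGate t, fun x y =>
    halfStepGate_nonneg (H.isHermitian a) (hH a) ht (hJ a) htJ x y⟩

/-- After `p` sweeps the uniform state is close to the ground state, up to normalization. -/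
theorem norm_sweep_pow_sub_le {H : LocalHamiltonian n k L} {J Δ t q : ℝ}
    (hJ : H.TermNormLE J) (hJ0 : 0 ≤ J) (hΔ : H.HasGap Δ) (ht : 0 ≤ t) (hs : t * (L * J) ≤ 1 / 2)
    {p : ℕ} (hq : q ≤ 1 / 2) (hp : p * (t * (L * J)) ^ 3 ≤ q / 64)
    (hdecay : Real.exp (-(p * t * Δ / 4)) ≤ q / 8) :
    ‖(Matrix.toEuclideanCLM (𝕜 := ℂ) (H.sweep t).prod ^ p) (plusState n) -
        ((taylorEigenvalue t H.groundEnergy ^ p : ℝ) : ℂ) • H.groundProj (plusState n)‖ ≤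
      taylorEigenvalue t H.groundEnergy ^ p * (q / 4) := by
  set S := Matrix.toEuclideanCLM (𝕜 := ℂ) (H.sweep t).prod
  set T := taylorStep t H.total
  set c := taylorEigenvalue t H.groundEnergy
  set d := (t * (L * J)) ^ 3
  have hd : 0 ≤ d := by positivity
  have hc : 1 / 2 ≤ c := one_half_le_taylorEigenvalue _ _
  have hcp : 0 < c ^ p := pow_pos (by linarith) p
  have hST : ‖S ^ p - T ^ p‖ ≤ c ^ p * (q / 16) := by
    refine (norm_pow_sub_pow_le (norm_taylorStep_le hJ hΔ ht hs)
      (norm_sweep_sub_taylorStep_le hJ hJ0 ht hs) p).trans ?_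
    have h1 : c + d ≤ c * Real.exp (2 * d) := by nlinarith [Real.add_one_le_exp (2 * d)]
    have h2 : (c + d) ^ p ≤ c ^ p * Real.exp (p * (2 * d)) := by
      rw [Real.exp_nat_mul, ← mul_pow]
      exact pow_le_pow_left₀ (by linarith) h1 p
    have h0 : 0 ≤ p * (2 * d) := by positivity
    have h3 := (abs_le.1 (Real.abs_exp_sub_one_le (x := p * (2 * d))
      (by rw [abs_of_nonneg h0]; linarith))).2
    rw [abs_of_nonneg h0] at h3
    have h4 : c ^ p * (Real.exp (p * (2 * d)) - 1) ≤ c ^ p * (q / 16) :=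
      mul_le_mul_of_nonneg_left (by linarith) hcp.le
    linarith
  have h5 : ‖(S ^ p) (plusState n) - (T ^ p) (plusState n)‖ ≤ c ^ p * (q / 16) := by
    have := ContinuousLinearMap.le_opNorm (S ^ p - T ^ p) (plusState n)
    rw [norm_plusState, mul_one] at this
    exact this.trans hST
  have h6 : ‖(T ^ p) (plusState n) - ((c ^ p : ℝ) : ℂ) • H.groundProj (plusState n)‖ ≤
      c ^ p * (q / 8) := (norm_taylorStep_pow_sub_le hJ hΔ ht hs p).trans
    (mul_le_mul_of_nonneg_left hdecay hcp.le)
  have hq0 : 0 ≤ q := by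
    have : 0 ≤ p * d := by positivity
    linarith
  refine (norm_sub_le_norm_sub_add_norm_sub _ ((T ^ p) (plusState n)) _).trans ?_
  nlinarith [mul_nonneg hcp.le hq0]

theorem toEuclideanCLM_plusState {A : QubitOp n} : Matrix.toEuclideanCLM (𝕜 := ℂ) A (plusState n) =
    ((1 / Real.sqrt (2 ^ n) : ℝ) : ℂ) • WithLp.toLp 2 (A.mulVec 1) := by
  have : plusState n = ((1 / Real.sqrt (2 ^ n) : ℝ) : ℂ) • WithLp.toLp 2 1 := by
    ext x
    simp [plusState]
  rw [this, map_smul, Matrix.toEuclideanCLM_toLp]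

/-- The classical Hamiltonian built from `p` sweeps: each sweep has `2 L` gates, and the Born
distribution needs two copies of the gate sequence. -/
theorem exists_gibbsMarginal_of_sweeps {H : LocalHamiltonian n k L} {J Δ t ε : ℝ}
    (hH : H.IsStoquastic) (hJ : H.TermNormLE J) (hJ0 : 0 ≤ J) (hΔ : H.HasGap Δ)
    (hη : 0 < H.overlap) (hε : 0 < ε) (hε1 : ε < 1) (ht : 0 ≤ t) (htJ : t * J ≤ 2)
    (hs : t * (L * J) ≤ 1 / 2) {p : ℕ}
    (hq : H.overlap * ε ≤ 1 / 2) (hp : p * (t * (L * J)) ^ 3 ≤ H.overlap * ε / 64)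
    (hdecay : Real.exp (-(p * t * Δ / 4)) ≤ H.overlap * ε / 8) :
    ∃ (m : ℕ) (G : ClassicalHamiltonian (Fin n ⊕ Fin m)),
      m ≤ k * (4 * L * p) ∧ G.numTerms = 4 * L * p ∧ G.IsLocal (2 * k) ∧ (∀ v, G.degree v ≤ 2) ∧
      tvDist G.gibbsMarginal H.groundDist ≤ ε := by
  set c := taylorEigenvalue t H.groundEnergy
  set η := H.overlap
  have hcp : 0 < c ^ p := pow_pos (taylorEigenvalue_pos _ _) p
  have hηε : 0 < η * ε := mul_pos hη hε
  obtain ⟨gates, hlen, hpos, hclose⟩ := exists_positive_gates_approx (k := k)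
    (List.replicate p (H.sweep t)).flatten (r := c ^ p * (η * ε / 8))
    (fun A hA => by
      obtain ⟨l, hl, hAl⟩ := List.mem_flatten.1 hA
      rw [List.eq_of_mem_replicate hl] at hAl
      exact exists_support_of_mem_sweep hH hJ ht htJ hAl) (by positivity)
  rw [List.prod_flatten, List.map_replicate, List.prod_replicate, map_pow] at hclose
  have hlen' : gates.length = 2 * L * p := by
    rw [hlen, List.length_flatten, List.map_replicate, List.sum_replicate]
    simp only [sweep, List.length_map, List.length_append, List.length_reverse,
      List.length_finRange, smul_eq_mul]
    ring
  obtain ⟨Hd, _, _, l, hl⟩ := exists_represents gates hpos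
  obtain ⟨m, G, hm, hG, hloc, hdeg, hmarg⟩ := hl.exists_gibbsMarginal
  rw [hlen'] at hm hG
  refine ⟨m, G, hm.trans_eq (by ring), hG.trans (by ring), hloc, hdeg, ?_⟩
  set φ : QubitSpace n := WithLp.toLp 2 (gates.prod.mulVec 1)
  have hα : 0 < (c ^ p)⁻¹ * (1 / Real.sqrt (2 ^ n)) := by positivity
  have happrox : ‖(((c ^ p)⁻¹ * (1 / Real.sqrt (2 ^ n)) : ℝ) : ℂ) • φ - (η : ℂ) • H.groundState‖ ≤
      3 / 8 * (η * ε) := by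
    have h1 : ‖Matrix.toEuclideanCLM (𝕜 := ℂ) gates.prod (plusState n) -
        ((c ^ p : ℝ) : ℂ) • H.groundProj (plusState n)‖ ≤ c ^ p * (3 / 8 * (η * ε)) := by
      have h2 := norm_sweep_pow_sub_le hJ hJ0 hΔ ht hs hq hp hdecay
      have h3 := ContinuousLinearMap.le_of_opNorm_le _ hclose (plusState n)
      rw [norm_plusState, mul_one] at h3
      refine (norm_sub_le_norm_sub_add_norm_sub _ ((Matrix.toEuclideanCLM (𝕜 := ℂ)
        (H.sweep t).prod ^ p) (plusState n)) _).trans ((add_le_add h3 h2).trans (le_of_eq ?_))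
      ring
    have h4 : (((c ^ p)⁻¹ * (1 / Real.sqrt (2 ^ n)) : ℝ) : ℂ) • φ - (η : ℂ) • H.groundState =
        (((c ^ p)⁻¹ : ℝ) : ℂ) • (Matrix.toEuclideanCLM (𝕜 := ℂ) gates.prod (plusState n) -
        ((c ^ p : ℝ) : ℂ) • H.groundProj (plusState n)) := by
      rw [toEuclideanCLM_plusState, smul_sub, smul_smul, smul_smul, ← Complex.ofReal_mul, ← Complex.ofReal_mul,
        inv_mul_cancel₀ hcp.ne', Complex.ofReal_one, one_smul, H.overlap_smul_groundState hη]
    rw [h4, norm_smul, Complex.norm_real, Real.norm_of_nonneg (inv_nonneg.2 hcp.le),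
      inv_mul_le_iff₀ hcp]
    exact h1
  have htv := tvDist_born_normalized_le hα hη (H.norm_groundState hη) (by nlinarith) happrox
  have h5 : G.gibbsMarginal = fun x => ‖φ x‖ ^ 2 / ∑ y, ‖φ y‖ ^ 2 := funext hmarg
  rw [h5]
  refine htv.trans ?_
  rw [div_le_iff₀ hη]
  nlinarith

/-! ### Uniform state when the overlap and the precision are large -/

/-- Without any term the marginal is the Born distribution of the uniform state, at distance at most
`√(1 - η²) ≤ ε` from the ground state distribution. -/
theorem exists_gibbsMarginal_uniform {H : LocalHamiltonian n k L} {ε : ℝ} (hη : 0 < H.overlap)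
    (hε : 0 < ε) (hq : 1 / 2 < H.overlap * ε) :
    ∃ (m : ℕ) (G : ClassicalHamiltonian (Fin n ⊕ Fin m)),
      m = 0 ∧ G.numTerms = 0 ∧ G.IsLocal (2 * k) ∧ (∀ v, G.degree v ≤ 2) ∧
      tvDist G.gibbsMarginal H.groundDist ≤ ε := by
  obtain ⟨Hd, _, _, l, hl⟩ := exists_represents (n := n) (k := k) [] (by simp)
  obtain ⟨m, G, hm, hG, hloc, hdeg, hmarg⟩ := hl.exists_gibbsMarginal
  refine ⟨m, G, by simpa using hm, by simpa using hG, hloc, hdeg, ?_⟩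
  have h1 : G.gibbsMarginal = fun x => ‖plusState n x‖ ^ 2 := by
    funext x
    rw [hmarg, List.prod_nil, Matrix.one_mulVec]
    simp only [plusState, Complex.norm_real]
    simp
  rw [h1]
  refine (tvDist_born_le (plusState n) H.groundState).trans ?_
  -- `‖a - b‖² ‖a + b‖² = (2 - 2 η) (2 + 2 η) = 4 (1 - η²)` for unit vectors with overlap `η`.
  have hsub := @norm_sub_sq ℂ _ _ _ _ (plusState n) H.groundState
  have hadd := @norm_add_sq ℂ _ _ _ _ (plusState n) H.groundState
  have hre : RCLike.re ⟪plusState n, H.groundState⟫_ℂ = H.overlap :=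
    H.re_inner_plusState_groundState hη
  rw [hre, norm_plusState, H.norm_groundState hη] at hsub hadd
  have h2 : (‖plusState n - H.groundState‖ * ‖plusState n + H.groundState‖) ^ 2 ≤ (2 * ε) ^ 2 := by
    rw [mul_pow, hsub, hadd]
    nlinarith [sq_nonneg (H.overlap - ε)]
  have h3 := (abs_le_of_sq_le_sq' h2 (by positivity)).2
  linarith

end LocalHamiltonian

/-! ### Choice of the number of sweeps and size bounds -/

theorem rpow_three_half_sq {x : ℝ} (hx : 0 ≤ x) : (x ^ (3 / 2 : ℝ)) ^ 2 = x ^ 3 := by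
  rw [← Real.rpow_natCast, ← Real.rpow_mul hx, ← Real.rpow_natCast]
  norm_num

theorem rpow_neg_half_sq {x : ℝ} (hx : 0 ≤ x) : (x ^ (-(1 / 2) : ℝ)) ^ 2 = x⁻¹ := by
  rw [← Real.rpow_natCast, ← Real.rpow_mul hx, ← Real.rpow_neg_one]
  norm_num

/-- The number of sweeps `p` for total evolution `K = β L J`: at least `2 K` so that a single step
is small, and `K³ / p²` small against `q`. -/
theorem exists_sweep_count {q K : ℝ} (hq : 0 < q) (hq1 : q ≤ 1) (hK : 1 ≤ K) :
    ∃ p : ℕ, 1 ≤ p ∧ 2 * K ≤ p ∧ 64 * K ^ 3 ≤ q * p ^ 2 ∧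
      p ≤ 9 * (K ^ (3 / 2 : ℝ) * q ^ (-(1 / 2) : ℝ)) := by
  set y := K ^ (3 / 2 : ℝ) * q ^ (-(1 / 2) : ℝ)
  have h1 : 1 ≤ q ^ (-(1 / 2) : ℝ) :=
    Real.one_le_rpow_of_pos_of_le_one_of_nonpos hq hq1 (by norm_num)
  have h2 : K ≤ K ^ (3 / 2 : ℝ) := Real.self_le_rpow_of_one_le hK (by norm_num)
  have hy : K ≤ y := h2.trans (le_mul_of_one_le_right (by linarith) h1)
  have hp := Nat.le_ceil (8 * y)
  have hp' := Nat.ceil_lt_add_one (a := 8 * y) (by linarith)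
  refine ⟨⌈8 * y⌉₊, ?_, by linarith, ?_, by linarith⟩
  · exact Nat.one_le_ceil_iff.2 (by linarith)
  · have hy2 : q * y ^ 2 = K ^ 3 := by
      rw [mul_pow, rpow_three_half_sq (by linarith), rpow_neg_half_sq hq.le]
      field_simp
    have h3 : (8 * y) ^ 2 ≤ (⌈8 * y⌉₊ : ℝ) ^ 2 := pow_le_pow_left₀ (by linarith) hp 2
    nlinarith

/-- Up to a factor, `sizeBound` is `L K^{3/2} q^{-1/2}`, with `K = β L J` for the evolution time
`β = 16 log (1 / q) / Δ` and `q = η ε`. -/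
theorem mul_rpow_eq_sizeBound {η J Δ ε : ℝ} {L : ℕ} (hη : 0 < η) (hε : 0 < ε) (hJ : 0 ≤ J)
    (hΔ : 0 < Δ) (hL : 0 < L) (hlog : 0 ≤ Real.log (η⁻¹ * ε⁻¹)) :
    L * ((16 * Real.log (η⁻¹ * ε⁻¹) / Δ * (L * J)) ^ (3 / 2 : ℝ) * (η * ε) ^ (-(1 / 2) : ℝ)) =
      64 * sizeBound η L J Δ ε := by
  have hL' : (0 : ℝ) < L := Nat.cast_pos.2 hL
  have h16 : (16 : ℝ) ^ (3 / 2 : ℝ) = 64 := by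
    have : (16 : ℝ) = 4 ^ (2 : ℝ) := by norm_num
    rw [this, ← Real.rpow_mul (by norm_num)]
    norm_num
  have hL2 : (L : ℝ) ^ (5 / 2 : ℝ) = L * (L : ℝ) ^ (3 / 2 : ℝ) := by
    rw [← Real.rpow_one_add' hL'.le (by norm_num)]
    norm_num
  rw [sizeBound, hL2, Real.mul_rpow (by positivity) (by positivity),
    Real.div_rpow (by positivity) hΔ.le, Real.mul_rpow (by norm_num) hlog,
    Real.mul_rpow hL'.le hJ, Real.mul_rpow hη.le hε.le, h16, Real.rpow_neg hΔ.le, div_eq_mul_inv]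
  ring

namespace LocalHamiltonian

variable {n k L : ℕ}

/-- If every qubit is touched by some term, the number of qubits is at most `k L`. -/
theorem card_le_of_actsNontrivially {H : LocalHamiltonian n k L}
    (h : ∀ i, ∃ a, ActsNontriviallyOn (H.term a) i) : n ≤ L * k := by
  choose S hS hsupp using H.isLocal
  have hcover : (Finset.univ : Finset (Fin n)) ⊆ Finset.univ.biUnion S := fun i _ => by
    obtain ⟨a, ha⟩ := h i
    refine Finset.mem_biUnion.2 ⟨a, Finset.mem_univ a, ?_⟩
    by_contra hi
    exact ha ((hsupp a).mono fun j hj => Finset.mem_erase.2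
      ⟨fun hji => hi (by rwa [hji] at hj), Finset.mem_univ j⟩)
  have := (Finset.card_le_card hcover).trans
    (Finset.card_biUnion_le_card_mul _ _ k fun a _ => hS a)
  simpa using this

end LocalHamiltonian

theorem mainTheorem1 :
    ∃ C : ℝ, 0 < C ∧
      ∀ (n k L : ℕ) (H : LocalHamiltonian n k L) (J Δ ε : ℝ),
        H.IsStoquastic →
        H.TermNormLE J →
        H.HasGap Δ →
        0 < H.overlap →
        0 < ε → ε < 1 →
        ∃ (m : ℕ) (G : ClassicalHamiltonian (Fin n ⊕ Fin m)),
          tvDist G.gibbsMarginal H.groundDist ≤ ε ∧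
          G.IsLocal (2 * k) ∧
          (∀ v, G.degree v ≤ 2) ∧
          (G.numTerms : ℝ) ≤ C * sizeBound H.overlap L J Δ ε ∧
          (m : ℝ) ≤ C * (k * sizeBound H.overlap L J Δ ε) ∧
          ((∀ i, ∃ a, ActsNontriviallyOn (H.term a) i) → H.overlap * ε ≤ 1 / 2 →
            ((n + m : ℕ) : ℝ) ≤ C * (k * sizeBound H.overlap L J Δ ε)) := by
  refine ⟨4608, by norm_num, fun n k L H J Δ ε hH hJ hΔ hη hε hε1 => ?_⟩
  have hΔ0 := hΔ.pos
  have hΔ2 := hΔ.le hJ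
  have hL : 0 < L := by
    rcases Nat.eq_zero_or_pos L with rfl | h
    · simp only [Nat.cast_zero, zero_mul, mul_zero] at hΔ2
      linarith
    · exact h
  have hJ0 : 0 ≤ J := (norm_nonneg _).trans (hJ ⟨0, hL⟩)
  have hL1 : (1 : ℝ) ≤ L := Nat.one_le_cast.2 hL
  have hLJ : 0 < L * J := by linarith
  have hq0 : 0 < H.overlap * ε := mul_pos hη hε
  have hq1 : H.overlap * ε ≤ 1 := by nlinarith [H.overlap_le_one]
  have hlog0 : 0 ≤ Real.log (H.overlap⁻¹ * ε⁻¹) := by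
    rw [← mul_inv]
    exact Real.log_nonneg ((one_le_inv₀ hq0).2 hq1)
  have hB : 0 ≤ sizeBound H.overlap L J Δ ε := by
    rw [sizeBound]
    positivity
  -- For `η ε` near `1` the logarithm, and with it `sizeBound`, tends to `0`: no term is allowed.
  rcases lt_or_ge (1 / 2) (H.overlap * ε) with hq | hq
  · obtain ⟨m, G, hm, hG, hloc, hdeg, htv⟩ :=
      LocalHamiltonian.exists_gibbsMarginal_uniform hη hε hq
    refine ⟨m, G, htv, hloc, hdeg, ?_, ?_, fun _ h => absurd h (not_le.2 hq)⟩
    · rw [hG, Nat.cast_zero]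
      positivity
    · rw [hm, Nat.cast_zero]
      positivity
  · set ℓ := Real.log (H.overlap⁻¹ * ε⁻¹) with hℓ
    have hℓq : ℓ = -Real.log (H.overlap * ε) := by rw [hℓ, ← mul_inv, Real.log_inv]
    have hℓ2 : 1 / 2 ≤ ℓ := by
      have h1 := Real.log_le_log hq0 hq
      rw [one_div, Real.log_inv] at h1
      linarith [Real.log_two_gt_d9]
    have hK : 1 ≤ 16 * ℓ / Δ * (L * J) := by
      rw [div_mul_eq_mul_div, le_div_iff₀ hΔ0]
      nlinarith
    obtain ⟨p, hp1, hpK, hpq, hpB⟩ := exists_sweep_count hq0 hq1 hK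
    have hp0 : (0 : ℝ) < p := Nat.cast_pos.2 hp1
    -- The total evolution time is `p t = 16 ℓ / Δ`, so that `exp (-p t Δ / 4) = q⁴`.
    have ht : 0 ≤ 16 * ℓ / Δ / p := by positivity
    have hs : 16 * ℓ / Δ / p * (L * J) ≤ 1 / 2 := by
      rw [div_mul_eq_mul_div, div_le_iff₀ hp0]
      linarith
    obtain ⟨m, G, hm, hG, hloc, hdeg, htv⟩ :=
      LocalHamiltonian.exists_gibbsMarginal_of_sweeps (p := p) hH hJ hJ0 hΔ hη hε hε1 ht
        (by nlinarith) hs hq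
        (by
          rw [div_mul_eq_mul_div (16 * ℓ / Δ), div_pow, mul_div_assoc', div_le_iff₀ (by positivity)]
          nlinarith)
        (by
          have h1 : -(p * (16 * ℓ / Δ / p) * Δ / 4) = ((4 : ℕ) : ℝ) * Real.log (H.overlap * ε) := by
            rw [hℓq]
            field_simp
            ring
          rw [h1, Real.exp_nat_mul, Real.exp_log hq0]
          have h2 : (H.overlap * ε) ^ 3 ≤ (1 / 2) ^ 3 := pow_le_pow_left₀ hq0.le hq 3
          nlinarith)
    have hnum : 4 * L * p ≤ 2304 * sizeBound H.overlap L J Δ ε := by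
      have h1 := mul_rpow_eq_sizeBound hη hε hJ0 hΔ0 hL hlog0
      have h2 := mul_le_mul_of_nonneg_left hpB (by positivity : (0 : ℝ) ≤ 4 * L)
      linarith
    have hmB : (m : ℝ) ≤ k * (2304 * sizeBound H.overlap L J Δ ε) := by
      have h1 : (m : ℝ) ≤ k * (4 * L * p) := by exact_mod_cast hm
      exact h1.trans (mul_le_mul_of_nonneg_left hnum (Nat.cast_nonneg k))
    refine ⟨m, G, htv, hloc, hdeg, ?_, ?_, fun hact _ => ?_⟩
    · rw [hG]
      push_cast
      linarith
    · have : 0 ≤ k * sizeBound H.overlap L J Δ ε := by positivity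
      linarith
    · have h1 : (n : ℝ) ≤ L * k := by
        exact_mod_cast LocalHamiltonian.card_le_of_actsNontrivially hact
      have h2 : (L : ℝ) ≤ 4 * L * p := by
        have : (1 : ℝ) ≤ p := Nat.one_le_cast.2 hp1
        nlinarith
      have h3 := mul_le_mul_of_nonneg_right (h2.trans hnum) (Nat.cast_nonneg (α := ℝ) k)
      push_cast
      linarith
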